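/- An election $(C,V)$ consists of a finite set $C$ of $m$ candidates and a finite list $V$ of votes, each a strict linear order over $C$; $\mathrm{pos}_v(c)\in\{1,\dots,m\}$ is the position of $c$ in the vote $v$. For $i\in\{1,\dots,m\}$ let $\mathrm{score}^i(c)$ be the number of votes $v\in V$ with $\mathrm{pos}_v(c)\le i$, let $\mathrm{sumpos}^i(c)$ be the sum of $\mathrm{pos}_v(c)$ over these votes, and let $\mathrm{maj}(V)=\lfloor |V|/2\rfloor+1$. The voting system SkS (Skating System Single) works as follows. Let $i^*$ be the smallest stage $i$ in which some candidate has $\mathrm{score}^i(c)\ge\mathrm{maj}(V)$. Starting with $S=C$ and $j=i^*$, let $S_j\subseteq S$ be the set of candidates of $S$ with the highest $\mathrm{score}^j$, and let $S_j'\subseteq S_j$ be the set of candidates of $S_j$ with the lowest $\mathrm{sumpos}^j$. If $|S_j|=1$, its sole member is the unique winner; otherwise, if $|S_j'|=1$, its sole member is the unique winner; otherwise, if $j=m$, all members of $S_j'$ are winners; otherwise the procedure is repeated with $S=S_j'$ in stage $j+1$. (If there are no votes, all candidates win.) Consider the following decision problem, SkS-DCAV (destructive control by adding voters in the unique-winner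 model). Given a set $C$ of candidates, a list $V$ of registered votes over $C$, a list $U$ of unregistered votes over $C$, a distinguished candidate $c\in C$, and an integer $k\ge 0$, is there a sublist $U'$ of $U$ with $|U'|\le k$ such that $c$ is not the unique SkS winner of the election $(C,V\cup U')$? Theorem. SkS-DCAV is in $\mathrm{P}$. -/

import Mathlib

open Computability

/-! ### Elections and the Skating System Single

A vote over a finite candidate set is a ranking: a duplicate-free list of exactly the candidates,
most preferred candidate first. -/

section Voting

variable {α : Type} [DecidableEq α]

/-- The (one-based) position of `c` in the ranking `v`. -/
def pos (v : List α) (c : α) : ℕ := v.idxOf c + 1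

/-- The number of votes in which `c` is among the top `i` positions. -/
def score (V : List (List α)) (i : ℕ) (c : α) : ℕ :=
  (V.map fun v => if pos v c ≤ i then 1 else 0).sum

/-- The sum of the positions of `c` over the votes in which `c` is among the top `i` positions. -/
def sumPos (V : List (List α)) (i : ℕ) (c : α) : ℕ :=
  (V.map fun v => pos v c * if pos v c ≤ i then 1 else 0).sum

/-- The majority threshold `⌊|V| / 2⌋ + 1`. -/
def maj (V : List (List α)) : ℕ := V.length / 2 + 1

/-- The candidates of `S` with the highest score in stage `j`. -/
def topScore (V : List (List α)) (j : ℕ) (S : Finset α) : Finset α :=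
  S.filter fun c => ∀ d ∈ S, score V j d ≤ score V j c

/-- The candidates of `S` with the lowest sum of positions in stage `j`. -/
def lowSum (V : List (List α)) (j : ℕ) (S : Finset α) : Finset α :=
  S.filter fun c => ∀ d ∈ S, sumPos V j c ≤ sumPos V j d

/-- The stages of SkS from stage `j` on, for the candidates `S` that are still in the race;
`m` is the last stage. -/
def sksFrom (V : List (List α)) (m j : ℕ) (S : Finset α) : Finset α :=
  if (topScore V j S).card = 1 then topScore V j S
  else if (lowSum V j (topScore V j S)).card = 1 then lowSum V j (topScore V j S)
  else if m ≤ j then lowSum V j (topScore V j S)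
  else sksFrom V m (j + 1) (lowSum V j (topScore V j S))
termination_by m - j

/-- The stages in `[m]`, `m = |C|`, in which at least one candidate reaches the majority
threshold. -/
def majStages (C : Finset α) (V : List (List α)) : Finset ℕ :=
  (Finset.Icc 1 C.card).filter fun i => ∃ c ∈ C, maj V ≤ score V i c

/-- The set of SkS winners of the election `(C, V)`: the procedure starts in the smallest stage in
which some candidate reaches the majority threshold. If there is no such stage (for a nonempty `C`
this only happens without any votes), no candidate is ever excluded and all candidates win. -/
def sksWinners (C : Finset α) (V : List (List α)) : Finset α :=
  if h : (majStages C V).Nonempty then sksFrom V C.card ((majStages C V).min' h) C else C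

end Voting

/-! ### Destructive control by adding voters

Candidates are named by natural numbers. -/

/-- A voting system maps a candidate set and a list of votes over it to the set of winners. -/
abbrev VotingSystem : Type := Finset ℕ → List (List ℕ) → Finset ℕ

/-- The data of an instance: the candidates, the registered votes, the unregistered votes, the
distinguished (despised) candidate, and the addition limit. -/
structure ControlData where
  cands : List ℕ
  votes : List (List ℕ)
  unreg : List (List ℕ)
  target : ℕ
  limit : ℕ

/-- The data form an instance: the candidates are listed without repetition, every vote is a ranking
of exactly these candidates, and the distinguished candidate is one of them. -/
def ControlData.IsInstance (I : ControlData) : Prop :=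
  I.cands.Nodup ∧ (∀ v ∈ I.votes, v.Perm I.cands) ∧ (∀ u ∈ I.unreg, u.Perm I.cands) ∧
    I.target ∈ I.cands

/-- The question in the unique-winner model: can at most `limit` unregistered votes be added such
that the distinguished candidate is not the unique winner? -/
def ControlData.DestructiveAddVoters (E : VotingSystem) (I : ControlData) : Prop :=
  ∃ U : List (List ℕ), U.Sublist I.unreg ∧ U.length ≤ I.limit ∧
    E I.cands.toFinset (I.votes ++ U) ≠ {I.target}

/-! ### Encoding of instances as words

Numbers are written in binary; the five components are listed one after the other. -/

/-- The binary representation of a number. -/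
def encNat (n : ℕ) : List Γ' := (encodeNat n).map Γ'.bit

/-- A list is written in brackets, with a comma behind every entry. -/
def encList {β : Type} (f : β → List Γ') (l : List β) : List Γ' :=
  Γ'.bra :: (l.flatMap fun x => f x ++ [Γ'.comma]) ++ [Γ'.ket]

/-- The word that represents `I`. -/
def ControlData.encode (I : ControlData) : List Γ' :=
  encList encNat I.cands ++ encList (encList encNat) I.votes ++
    encList (encList encNat) I.unreg ++ encNat I.target ++ [Γ'.comma] ++ encNat I.limit

/-- The decision problem `E`-DCAV in the unique-winner model, as a language: the encodings of the
yes-instances. -/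
def DCAV (E : VotingSystem) : Language Γ' :=
  {w | ∃ I : ControlData, I.IsInstance ∧ I.encode = w ∧ I.DestructiveAddVoters E}

/-! ### The class P -/

/-- `L` is in P: some (multi-stack) Turing machine with a polynomial time bound, in the length of
the input word, decides membership in `L` on every word over the alphabet. -/
def InP {Γ : Type} [Fintype Γ] (L : Language Γ) : Prop :=
  ∃ f : List Γ → Bool, (∀ w, f w = true ↔ w ∈ L) ∧
    Nonempty (Turing.TM2ComputableInPolyTime (id : List Γ → List Γ) encodeBool f)

/-! ### The encoding is injective -/

theorem encNat_cancel {a b : ℕ} {s t : List Γ'}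
    (h : encNat a ++ Γ'.comma :: s = encNat b ++ Γ'.comma :: t) : a = b ∧ s = t := by
  have key : ∀ (x y : List Bool), x.map Γ'.bit ++ Γ'.comma :: s = y.map Γ'.bit ++ Γ'.comma :: t →
      x = y ∧ s = t := by
    intro x
    induction x with
    | nil => intro y h; cases y <;> simp_all
    | cons b x ih =>
      intro y h
      cases y with
      | nil => simp at h
      | cons b' y =>
        simp only [List.map_cons, List.cons_append, List.cons.injEq, Γ'.bit.injEq] at h
        obtain ⟨h1, h2⟩ := ih y h.2
        exact ⟨by rw [h.1, h1], h2⟩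
  obtain ⟨h1, h2⟩ := key _ _ h
  refine ⟨?_, h2⟩
  have h3 := congrArg decodeNat h1
  simpa using h3

theorem encList_cancel {β : Type} {f : β → List Γ'}
    (hf : ∀ {a b : β} {s t : List Γ'}, f a ++ Γ'.comma :: s = f b ++ Γ'.comma :: t → a = b ∧ s = t)
    (hk : ∀ (a : β) (s t : List Γ'), f a ++ Γ'.comma :: s ≠ Γ'.ket :: t)
    {k l : List β} {s t : List Γ'} (h : encList f k ++ s = encList f l ++ t) : k = l ∧ s = t := by
  simp only [encList, List.cons_append, List.append_assoc, List.cons.injEq, true_and,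
    List.nil_append] at h
  induction k generalizing l with
  | nil =>
    cases l with
    | nil => simpa using h
    | cons b l =>
      simp only [List.flatMap_nil, List.nil_append, List.flatMap_cons, List.append_assoc,
        List.cons_append] at h
      exact absurd h.symm (hk _ _ _)
  | cons a k ih =>
    cases l with
    | nil =>
      simp only [List.flatMap_nil, List.nil_append, List.flatMap_cons, List.append_assoc,
        List.cons_append] at h
      exact absurd h (hk _ _ _)
    | cons b l =>
      simp only [List.nil_append, List.flatMap_cons, List.append_assoc, List.cons_append] at h
      obtain ⟨h1, h2⟩ := hf h
      obtain ⟨h3, h4⟩ := ih h2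
      exact ⟨by rw [h1, h3], h4⟩

theorem encNat_ne_ket (a : ℕ) (s t : List Γ') : encNat a ++ Γ'.comma :: s ≠ Γ'.ket :: t := by
  unfold encNat
  cases encodeNat a <;> simp

theorem encode_injective : Function.Injective ControlData.encode := by
  rintro ⟨C, V, U, c, k⟩ ⟨C', V', U', c', k'⟩ h
  simp only [ControlData.encode, List.append_assoc, List.cons_append, List.nil_append] at h
  have hn : ∀ {k l : List ℕ} {s t : List Γ'}, encList encNat k ++ s = encList encNat l ++ t →
      k = l ∧ s = t := fun h => encList_cancel encNat_cancel encNat_ne_ket h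
  have hv : ∀ {k l : List (List ℕ)} {s t : List Γ'},
      encList (encList encNat) k ++ s = encList (encList encNat) l ++ t → k = l ∧ s = t := by
    intro k l s t h
    refine encList_cancel (fun h => ?_) (fun a s t => by simp [encList]) h
    obtain ⟨h1, h2⟩ := hn h
    exact ⟨h1, (List.cons.inj h2).2⟩
  obtain ⟨h1, g1⟩ := hn h
  obtain ⟨h2, g2⟩ := hv g1
  obtain ⟨h3, g3⟩ := hv g2
  obtain ⟨h4, g4⟩ := encNat_cancel g3
  have g5 : encNat k ++ Γ'.comma :: [] = encNat k' ++ Γ'.comma :: [] := by rw [g4]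
  obtain ⟨h5, -⟩ := encNat_cancel g5
  rw [h1, h2, h3, h4, h5]

/-!
Membership in P is shown by an explicit criterion for the despised candidate `c` not to be the
unique winner, a greedy algorithm that checks this criterion, and a proof that the algorithm runs
in polynomial time on a multi-stack Turing machine.

**The criterion.** If `B` exceeds all sums of positions, the scores and the sums of positions of a
stage can be merged into one number, the sum of `B - pos` over the votes that count in this stage
(`stageWeight`). From the first stage in which somebody has a majority, SkS thus selects the
candidates with the lexicographically largest sequences of stage weights (`sksFrom_eq`). It
follows (`sksWinners_ne_singleton_iff`) that `c` is not the unique winner if and only if some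
other candidate `d` and some stage `i` satisfy: `c` has no majority in stage `i - 1`, `d` has a
majority in stage `i`, and from stage `i` on, `d` is lexicographically at least as good as `c`.
One does not have to know the first stage in which anyone reaches the majority, and no other
candidates play a role. If there are no votes at all, everyone wins, and it only matters whether
`c` is alone.

**The greedy algorithm.** Fix `d` and `i`. An unregistered vote influences the first two
conditions only through the two bits that tell whether `c` is placed before position `i`, and
whether `d` is placed up to position `i`. There are therefore four classes of votes, and the
numbers of votes added from each class determine whether these conditions hold. For the third
condition, the votes of each class should have the lexicographically largest differences of the
contributions to the stage weights of `d` and `c`; the lexicographic order on integer sequences is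
a group order, so the greedy choice maximizes the sum (`sum_le_sum_greedy`). It suffices to try
all numbers for the four classes (`exists_spoils_iff`).

**Polynomial time.** `PT` is the class of functions of a word and several unary numbers that while
programs with polynomially bounded counters compute in polynomial time. It is closed under
substitution and under primitive recursion with polynomially bounded values (`PT.recursion`),
hence under sums, bounded quantifiers and the like, and while programs compile to Turing machines
(`Cmd.machine`, `InP.of_exec`). The candidates' names and the addition limit are binary numbers of
unbounded size; names are only compared for equality, as words (`PTWord`), and the limit is only
needed up to the number of unregistered votes (`PT.min_binVal`). A word encodes an instance with
given numbers of candidates and votes if and only if it is reproduced by cutting it at its commas,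
reading the pieces as numerals, and encoding the result (`Reads`).
-/

/-! ### Lexicographic comparison and greedy selection -/

/-- `f` is lexicographically at least `g` on the interval from `i` to `m`. -/
def LexGe (i m : ℕ) (f g : ℕ → ℤ) : Prop :=
  ∀ j, i ≤ j → j ≤ m → (∀ j', i ≤ j' → j' < j → f j' = g j') → g j ≤ f j

/-- The restriction of `f` to the interval from `i` to `m`, as an element of the lexicographically
ordered group of integer sequences. -/
def lexKey (i m : ℕ) (f : ℕ → ℤ) : Lex (ℕ → ℤ) :=
  toLex fun j => if i ≤ j ∧ j ≤ m then f j else 0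

theorem lexKey_le_iff {i m : ℕ} {f g : ℕ → ℤ} : lexKey i m g ≤ lexKey i m f ↔ LexGe i m f g := by
  constructor
  · intro h j hij hjm heq
    have := Pi.apply_le_of_toLex (i := j) h fun j' hj' => by
      by_cases h' : i ≤ j' ∧ j' ≤ m
      · simp only [if_pos h']
        exact (heq j' h'.1 hj').symm
      · simp only [if_neg h']
    simpa [hij, hjm] using this
  · intro h
    by_contra hlt
    obtain ⟨j, hj, hlt⟩ := not_le.1 hlt
    simp only [lexKey, Pi.toLex_apply] at hj hlt
    by_cases hjm : i ≤ j ∧ j ≤ m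
    · simp only [if_pos hjm] at hlt
      refine absurd (h j hjm.1 hjm.2 fun j' h1 h2 => ?_) (not_le.2 hlt)
      have := hj j' h2
      rwa [if_pos ⟨h1, by lia⟩, if_pos ⟨h1, by lia⟩] at this
    · simp [if_neg hjm] at hlt

theorem lexKey_add (i m : ℕ) (f g : ℕ → ℤ) :
    lexKey i m (fun j => f j + g j) = lexKey i m f + lexKey i m g := by
  funext j
  change (if i ≤ j ∧ j ≤ m then f j + g j else 0) =
    (if i ≤ j ∧ j ≤ m then f j else 0) + (if i ≤ j ∧ j ≤ m then g j else 0)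
  split_ifs <;> simp

theorem lexKey_sum {ι : Type*} (i m : ℕ) (s : Finset ι) (f : ι → ℕ → ℤ) :
    lexKey i m (fun j => ∑ u ∈ s, f u j) = ∑ u ∈ s, lexKey i m (f u) := by
  classical
  induction s using Finset.induction_on with
  | empty =>
    funext j
    change (if i ≤ j ∧ j ≤ m then ∑ u ∈ ∅, f u j else 0) = 0
    simp
  | insert a s ha ih => simp only [Finset.sum_insert ha, lexKey_add, ih]

theorem LexGe.trans {i m : ℕ} {f g h : ℕ → ℤ} (hfg : LexGe i m f g) (hgh : LexGe i m g h) :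
    LexGe i m f h :=
  lexKey_le_iff.1 ((lexKey_le_iff.2 hgh).trans (lexKey_le_iff.2 hfg))

theorem lexGe_iff_succ {i m : ℕ} (him : i ≤ m) {f g : ℕ → ℤ} :
    LexGe i m f g ↔ g i ≤ f i ∧ (f i = g i → LexGe (i + 1) m f g) := by
  constructor
  · intro h
    refine ⟨h i le_rfl him fun j' h1 h2 => absurd h1 (not_le.2 h2), fun he j hij hjm heq => ?_⟩
    refine h j (by lia) hjm fun j' h1 h2 => ?_
    rcases h1.eq_or_lt with rfl | h1
    · exact he
    · exact heq j' h1 h2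
  · rintro ⟨h1, h2⟩ j hij hjm heq
    rcases hij.eq_or_lt with rfl | hij
    · exact h1
    · exact h2 (heq i le_rfl hij) j hij hjm fun j' h3 h4 => heq j' (by lia) h4

section Greedy

variable {M : Type*} [LinearOrder M]

/-- `u'` is preferred to `u`: it has a larger key, or the same key and a smaller index. -/
def Preferred (key : ℕ → M) (u' u : ℕ) : Prop := key u < key u' ∨ key u = key u' ∧ u' < u

open Classical in
/-- The number of elements of the class of `u` among the first `n` that are preferred to `u`. -/
noncomputable def rankIn (n : ℕ) (cl : ℕ → ℕ) (key : ℕ → M) (u : ℕ) : ℕ :=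
  ((Finset.range n).filter fun u' => cl u' = cl u ∧ Preferred key u' u).card

/-- The greedy selection: of every class `t`, the `q t` elements that are preferred to the
others. -/
noncomputable def greedy (n : ℕ) (cl : ℕ → ℕ) (key : ℕ → M) (q : ℕ → ℕ) : Finset ℕ :=
  (Finset.range n).filter fun u => rankIn n cl key u < q (cl u)

variable {n : ℕ} {cl : ℕ → ℕ} {key : ℕ → M}

theorem rankIn_lt {u v : ℕ} (hv : v < n) (hc : cl v = cl u) (h : Preferred key v u) :
    rankIn n cl key v < rankIn n cl key u := by
  classical
  refine Finset.card_lt_card ⟨fun x hx => ?_, fun hsub => ?_⟩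
  · simp only [Finset.mem_filter] at hx ⊢
    refine ⟨hx.1, hx.2.1.trans hc, ?_⟩
    have hx := hx.2.2
    unfold Preferred at *
    rcases hx with hx | hx <;> rcases h with h | h
    · exact .inl (h.trans hx)
    · exact .inl (h.1 ▸ hx)
    · exact .inl (hx.1 ▸ h)
    · exact .inr ⟨h.1.trans hx.1, hx.2.trans h.2⟩
  · have : v ∈ (Finset.range n).filter fun u' => cl u' = cl v ∧ Preferred key u' v :=
      hsub (Finset.mem_filter.2 ⟨Finset.mem_range.2 hv, hc, h⟩)
    have := (Finset.mem_filter.1 this).2.2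
    unfold Preferred at this
    rcases this with h | h
    · exact lt_irrefl _ h
    · exact lt_irrefl _ h.2

theorem preferred_total (key : ℕ → M) {u v : ℕ} (h : u ≠ v) :
    Preferred key u v ∨ Preferred key v u := by
  unfold Preferred
  rcases lt_trichotomy (key u) (key v) with h1 | h1 | h1
  · exact .inr (.inl h1)
  · rcases lt_or_gt_of_ne h with h2 | h2
    · exact .inl (.inr ⟨h1.symm, h2⟩)
    · exact .inr (.inr ⟨h1, h2⟩)
  · exact .inl (.inl h1)

/-- In a class, the ranks are the numbers `0, 1, 2, …`. -/
theorem card_greedy_class {q : ℕ → ℕ} {t : ℕ}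
    (hq : q t ≤ ((Finset.range n).filter fun u => cl u = t).card) :
    ((greedy n cl key q).filter fun u => cl u = t).card = q t := by
  classical
  set T := (Finset.range n).filter fun u => cl u = t with hT
  have hinj : Set.InjOn (rankIn n cl key) T := by
    intro u hu v hv huv
    simp only [hT, Finset.coe_filter, Finset.mem_range, Set.mem_ofPred_eq] at hu hv
    by_contra hne
    rcases preferred_total key hne with h | h
    · exact (rankIn_lt hu.1 (hu.2.trans hv.2.symm) h).ne huv
    · exact (rankIn_lt hv.1 (hv.2.trans hu.2.symm) h).ne huv.symm
  have hmaps : T.image (rankIn n cl key) ⊆ Finset.range T.card := by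
    intro r hr
    obtain ⟨u, hu, rfl⟩ := Finset.mem_image.1 hr
    have hu' := Finset.mem_filter.1 hu
    refine Finset.mem_range.2 (Finset.card_lt_card ⟨fun x hx => ?_, fun hsub => ?_⟩)
    · simp only [Finset.mem_filter] at hx
      exact Finset.mem_filter.2 ⟨hx.1, hx.2.1.trans hu'.2⟩
    · have := (Finset.mem_filter.1 (hsub hu)).2.2
      unfold Preferred at this
      simp at this
  have himg : T.image (rankIn n cl key) = Finset.range T.card :=
    Finset.eq_of_subset_of_card_le hmaps
      (by rw [Finset.card_image_of_injOn hinj, Finset.card_range])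
  have h1 : ((greedy n cl key q).filter fun u => cl u = t) =
      T.filter fun u => rankIn n cl key u < q t := by
    ext u
    simp only [greedy, hT, Finset.mem_filter]
    constructor
    · rintro ⟨⟨h1, h2⟩, rfl⟩
      exact ⟨⟨h1, rfl⟩, h2⟩
    · rintro ⟨⟨h1, rfl⟩, h2⟩
      exact ⟨⟨h1, h2⟩, rfl⟩
  have h2 : (T.filter fun u => rankIn n cl key u < q t).image (rankIn n cl key) =
      Finset.range (q t) := by
    ext r
    simp only [Finset.mem_image, Finset.mem_filter, Finset.mem_range]
    constructor
    · rintro ⟨u, ⟨-, h⟩, rfl⟩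
      exact h
    · intro hr
      have : r ∈ T.image (rankIn n cl key) := himg ▸ Finset.mem_range.2 (hr.trans_le hq)
      obtain ⟨u, hu, rfl⟩ := Finset.mem_image.1 this
      exact ⟨u, ⟨hu, hr⟩, rfl⟩
  rw [h1, ← Finset.card_image_of_injOn (hinj.mono fun x hx => (Finset.mem_filter.1 hx).1), h2,
    Finset.card_range]

variable [AddCommGroup M] [IsOrderedAddMonoid M]

/-- An exchange argument: the elements of `s` outside of `t` are matched with those of `t` outside
of `s`. -/
theorem sum_le_sum_of_card_eq {s t : Finset ℕ} {f : ℕ → M} (hc : s.card = t.card)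
    (h : ∀ v ∈ s \ t, ∀ u ∈ t \ s, f v ≤ f u) : ∑ v ∈ s, f v ≤ ∑ u ∈ t, f u := by
  have hc' : (s \ t).card = (t \ s).card := by
    have h1 := Finset.card_sdiff_add_card_inter s t
    have h2 := Finset.card_sdiff_add_card_inter t s
    rw [Finset.inter_comm] at h2
    lia
  rw [← Finset.sum_inter_add_sum_sdiff s t, ← Finset.sum_inter_add_sum_sdiff t s,
    Finset.inter_comm t s]
  gcongr _ + ?_
  rw [← Finset.sum_coe_sort (s \ t), ← Finset.sum_coe_sort (t \ s),
    ← (Finset.equivOfCardEq hc').sum_comp]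
  exact Finset.sum_le_sum fun v _ => h v v.2 _ (Finset.equivOfCardEq hc' v).2

/-- The greedy selection maximizes the sum of the keys among the sets with the same class sizes. -/
theorem sum_le_sum_greedy {A : Finset ℕ} (hA : A ⊆ Finset.range n) {q : ℕ → ℕ}
    (hq : ∀ t, q t = (A.filter fun u => cl u = t).card) :
    (∀ h : ℕ → ℕ, ∑ u ∈ greedy n cl key q, h (cl u) = ∑ u ∈ A, h (cl u)) ∧
      ∑ u ∈ A, key u ≤ ∑ u ∈ greedy n cl key q, key u := by
  set G := greedy n cl key q with hG
  have hGn : G ⊆ Finset.range n := Finset.filter_subset _ _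
  have hcard : ∀ t, (G.filter fun u => cl u = t).card = q t := fun t =>
    card_greedy_class (by rw [hq]; exact Finset.card_le_card (Finset.filter_subset_filter _ hA))
  let T := (Finset.range n).image cl
  have hmA : ∀ u ∈ A, cl u ∈ T := fun u hu => Finset.mem_image_of_mem _ (hA hu)
  have hmG : ∀ u ∈ G, cl u ∈ T := fun u hu => Finset.mem_image_of_mem _ (hGn hu)
  constructor
  · intro h
    rw [← Finset.sum_fiberwise_of_maps_to hmA, ← Finset.sum_fiberwise_of_maps_to hmG]
    refine Finset.sum_congr rfl fun t _ => ?_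
    have : ∀ B : Finset ℕ, ∑ u ∈ B with cl u = t, h (cl u) =
        (B.filter fun u => cl u = t).card * h t := fun B => by
      rw [Finset.sum_congr rfl (g := fun _ => h t) fun u hu => by rw [(Finset.mem_filter.1 hu).2]]
      simp
    rw [this, this, hcard, hq]
  · rw [← Finset.sum_fiberwise_of_maps_to hmA, ← Finset.sum_fiberwise_of_maps_to hmG]
    refine Finset.sum_le_sum fun t _ => sum_le_sum_of_card_eq (by rw [hcard, hq]) ?_
    intro v hv u hu
    simp only [Finset.mem_sdiff, Finset.mem_filter, not_and] at hv hu
    obtain ⟨⟨hvA, rfl⟩, hvG⟩ := hv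
    have hr : rankIn n cl key u < q (cl v) := by
      have := (Finset.mem_filter.1 (hG ▸ hu.1.1)).2
      rwa [hu.1.2] at this
    have hr' : ¬ rankIn n cl key v < q (cl v) := fun h =>
      hvG (hG ▸ Finset.mem_filter.2 ⟨hA hvA, h⟩) rfl
    by_contra hlt
    have := rankIn_lt (n := n) (cl := cl) (Finset.mem_range.1 (hA hvA)) hu.1.2.symm
      (.inl (not_le.1 hlt) : Preferred key v u)
    lia

end Greedy

/-! ### The winners of the Skating System Single -/

section Winners

variable {α : Type} [DecidableEq α]

/-- The score and the sum of positions in stage `j`, combined to one number: every vote in which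
`c` is among the top `j` positions contributes `B` minus the position. -/
def stageWeight (B : ℕ) (V : List (List α)) (j : ℕ) (c : α) : ℕ :=
  (V.map fun v => if pos v c ≤ j then B - pos v c else 0).sum

theorem stageWeight_add_sumPos {B j : ℕ} (hj : j ≤ B) (V : List (List α)) (c : α) :
    stageWeight B V j c + sumPos V j c = B * score V j c := by
  induction V with
  | nil => rfl
  | cons v V ih =>
    simp only [stageWeight, sumPos, score, List.map_cons, List.sum_cons] at ih ⊢
    rw [mul_add, ← ih]
    split_ifs <;> lia

theorem sumPos_le (V : List (List α)) (j : ℕ) (c : α) : sumPos V j c ≤ V.length * j := by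
  induction V with
  | nil => simp [sumPos]
  | cons v V ih =>
    simp only [sumPos, List.map_cons, List.sum_cons, List.length_cons] at ih ⊢
    rw [Nat.succ_mul, add_comm]
    gcongr
    split_ifs <;> lia

theorem score_mono (V : List (List α)) {i j : ℕ} (hij : i ≤ j) (c : α) :
    score V i c ≤ score V j c := by
  unfold score
  refine List.sum_le_sum fun v _ => ?_
  split_ifs <;> lia

theorem score_zero (V : List (List α)) (c : α) : score V 0 c = 0 := by
  simp [score, pos]

variable {B m : ℕ} {V : List (List α)}

/-- If `B` exceeds all sums of positions, the stage weights compare the scores first. -/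
theorem score_le_of_stageWeight_le (hB : V.length * m < B) (hmB : m ≤ B) {j : ℕ} (hj : j ≤ m)
    {c d : α} (h : stageWeight B V j c ≤ stageWeight B V j d) : score V j c ≤ score V j d := by
  by_contra hlt
  have h1 := stageWeight_add_sumPos (hj.trans hmB) V c
  have h2 := stageWeight_add_sumPos (hj.trans hmB) V d
  have h3 : sumPos V j c < B :=
    ((sumPos_le V j c).trans (Nat.mul_le_mul_left _ hj)).trans_lt hB
  have h4 : B * (score V j d + 1) ≤ B * score V j c := Nat.mul_le_mul_left _ (not_le.1 hlt)
  rw [mul_add] at h4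
  lia

theorem lowSum_singleton (V : List (List α)) (j : ℕ) (c : α) : lowSum V j {c} = {c} := by
  ext d
  simp only [lowSum, Finset.mem_filter, Finset.mem_singleton, forall_eq, and_iff_left_iff_imp]
  rintro rfl
  rfl

theorem lowSum_topScore (hB : V.length * m < B) (hmB : m ≤ B) {j : ℕ} (hj : j ≤ m)
    (S : Finset α) : lowSum V j (topScore V j S) =
      S.filter fun c => ∀ d ∈ S, stageWeight B V j d ≤ stageWeight B V j c := by
  ext c
  rw [lowSum, Finset.mem_filter, Finset.mem_filter]
  simp only [topScore, Finset.mem_filter, and_assoc]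
  refine and_congr_right fun hc => ?_
  have key := fun d => stageWeight_add_sumPos (B := B) (hj.trans hmB) V d
  constructor
  · rintro ⟨h1, h2⟩ d hd
    by_cases he : score V j d = score V j c
    · have := h2 d ⟨hd, fun e he' => (h1 e he').trans he.ge⟩
      have h3 := key c
      have h4 := key d
      rw [he] at h4
      lia
    · by_contra hlt
      exact he (le_antisymm (h1 d hd) (score_le_of_stageWeight_le hB hmB hj (not_le.1 hlt).le))
  · intro h
    have h1 : ∀ d ∈ S, score V j d ≤ score V j c := fun d hd =>
      score_le_of_stageWeight_le hB hmB hj (h d hd)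
    refine ⟨h1, fun d ⟨hd, hd'⟩ => ?_⟩
    have he : score V j d = score V j c := le_antisymm (h1 d hd) (hd' c hc)
    have h3 := key c
    have h4 := key d
    have h5 := h d hd
    rw [he] at h4
    lia

/-- From stage `j` on, SkS selects the candidates with the lexicographically largest stage
weights. -/
theorem sksFrom_eq (hB : V.length * m < B) (hmB : m ≤ B) {j : ℕ} (hj : j ≤ m) (S : Finset α) :
    ∀ c, c ∈ sksFrom V m j S ↔ c ∈ S ∧ ∀ d ∈ S, LexGe j m (fun i => (stageWeight B V i c : ℤ))
      fun i => (stageWeight B V i d : ℤ) := by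
  induction hk : m - j generalizing j S with
  | zero =>
    obtain rfl : j = m := by lia
    have hlast : ∀ c d, LexGe j j (fun i => (stageWeight B V i c : ℤ))
        (fun i => (stageWeight B V i d : ℤ)) ↔ stageWeight B V j d ≤ stageWeight B V j c := by
      intro c d
      rw [lexGe_iff_succ le_rfl, Nat.cast_le, and_iff_left_iff_imp]
      intro _ _ i h1 h2
      lia
    have hlow := lowSum_topScore hB hmB hj S
    intro c
    simp only [hlast]
    have hmem : ∀ c, c ∈ lowSum V j (topScore V j S) ↔
        c ∈ S ∧ ∀ d ∈ S, stageWeight B V j d ≤ stageWeight B V j c := by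
      intro c
      rw [hlow, Finset.mem_filter]
    rw [← hmem, sksFrom]
    split_ifs with h1
    · obtain ⟨x, hx⟩ := Finset.card_eq_one.1 h1
      rw [hx, lowSum_singleton]
    · rfl
    · rfl
  | succ k ih =>
    have hlow := lowSum_topScore hB hmB hj S
    set S' := lowSum V j (topScore V j S) with hS'
    have hmem : ∀ c, c ∈ S' ↔ c ∈ S ∧ ∀ d ∈ S, stageWeight B V j d ≤ stageWeight B V j c := by
      intro c
      rw [hlow, Finset.mem_filter]
    -- A candidate that survives alone beats all others strictly in this stage.
    have hone : ∀ x, S' = {x} → ∀ c, c ∈ S' ↔ c ∈ S ∧ ∀ d ∈ S,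
        LexGe j m (fun i => (stageWeight B V i c : ℤ)) fun i => (stageWeight B V i d : ℤ) := by
      intro x hx c
      constructor
      · intro hc
        have hcx : c = x := by rw [hx] at hc; exact Finset.mem_singleton.1 hc
        subst hcx
        refine ⟨((hmem c).1 hc).1, fun d hd => ?_⟩
        rw [lexGe_iff_succ hj]
        refine ⟨by exact_mod_cast ((hmem c).1 hc).2 d hd, fun he => ?_⟩
        have he : stageWeight B V j c = stageWeight B V j d := by exact_mod_cast he
        have hd' : d ∈ S' := (hmem d).2 ⟨hd, fun e he' => he ▸ ((hmem c).1 hc).2 e he'⟩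
        rw [hx] at hd'
        rw [Finset.mem_singleton.1 hd']
        exact fun i _ _ _ => le_rfl
      · rintro ⟨h1, h2⟩
        refine (hmem c).2 ⟨h1, fun d hd => ?_⟩
        exact_mod_cast ((lexGe_iff_succ hj).1 (h2 d hd)).1
    intro c
    rw [sksFrom, ← hS']
    split_ifs with h1 h2 h2
    · obtain ⟨x, hx⟩ := Finset.card_eq_one.1 h1
      have hx' : S' = {x} := by rw [hS', hx, lowSum_singleton]
      rw [hx, ← hx']
      exact hone x hx' c
    · obtain ⟨x, hx⟩ := Finset.card_eq_one.1 h2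
      exact hone x hx c
    · lia
    · rw [ih (by lia) S' (by lia)]
      constructor
      · rintro ⟨hc, h⟩
        have hc' := (hmem c).1 hc
        refine ⟨hc'.1, fun d hd => (lexGe_iff_succ hj).2
          ⟨by exact_mod_cast hc'.2 d hd, fun he => h d ?_⟩⟩
        have he : stageWeight B V j c = stageWeight B V j d := by exact_mod_cast he
        exact (hmem d).2 ⟨hd, fun e he' => he ▸ hc'.2 e he'⟩
      · rintro ⟨hc, h⟩
        have hc' : ∀ d ∈ S, stageWeight B V j d ≤ stageWeight B V j c := fun d hd => by
          exact_mod_cast ((lexGe_iff_succ hj).1 (h d hd)).1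
        refine ⟨(hmem c).2 ⟨hc, hc'⟩, fun d hd => ?_⟩
        have hd' := (hmem d).1 hd
        refine ((lexGe_iff_succ hj).1 (h d hd'.1)).2 ?_
        have h3 := hc' d hd'.1
        have h4 := hd'.2 c hc
        exact_mod_cast le_antisymm h4 h3

variable {C : Finset α}

/-- A candidate `c` fails to be the unique winner if and only if there are another candidate `d` and
a stage `i`, such that `d` has reached the majority threshold by stage `i`, `c` had not reached it
before, and `d` is at least as good as `c` from stage `i` on. Neither the other candidates nor the
first stage in which anyone reaches the threshold occur in this criterion. -/
theorem sksWinners_ne_singleton_iff (hV : V ≠ []) (hpos : ∀ v ∈ V, ∀ c ∈ C, pos v c ≤ C.card)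
    (hB : V.length * C.card < B) (hmB : C.card ≤ B) {c : α} (hc : c ∈ C) :
    sksWinners C V ≠ {c} ↔ ∃ d ∈ C, d ≠ c ∧ ∃ i, 1 ≤ i ∧ i ≤ C.card ∧
      2 * score V (i - 1) c ≤ V.length ∧ V.length < 2 * score V i d ∧
      LexGe i C.card (fun j => (stageWeight B V j d : ℤ)) fun j => (stageWeight B V j c : ℤ) := by
  have hlast : ∀ c ∈ C, score V C.card c = V.length := by
    intro c hc
    rw [score, List.map_congr_left (g := fun _ => 1) fun v hv => if_pos (hpos v hv c hc)]
    simp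
  have hlen : 0 < V.length := List.length_pos_iff.2 hV
  have hmaj : ∀ n : ℕ, maj V ≤ n ↔ V.length < 2 * n := fun n => by unfold maj; lia
  have hne : (majStages C V).Nonempty := by
    refine ⟨C.card, ?_⟩
    simp only [majStages, Finset.mem_filter, Finset.mem_Icc]
    exact ⟨⟨Finset.card_pos.2 ⟨c, hc⟩, le_rfl⟩, c, hc, by rw [hmaj, hlast c hc]; lia⟩
  set i₀ := (majStages C V).min' hne with hi₀
  have hi₀mem := (majStages C V).min'_mem hne
  rw [← hi₀, majStages, Finset.mem_filter, Finset.mem_Icc] at hi₀mem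
  obtain ⟨⟨hi1, him⟩, e, he, hemaj⟩ := hi₀mem
  have hmin : ∀ i, 1 ≤ i → i ≤ C.card → ∀ d ∈ C, maj V ≤ score V i d → i₀ ≤ i :=
    fun i h1 h2 d hd h3 => Finset.min'_le _ _ (by
      rw [majStages, Finset.mem_filter, Finset.mem_Icc]
      exact ⟨⟨h1, h2⟩, d, hd, h3⟩)
  have hmem : ∀ x, x ∈ sksWinners C V ↔ x ∈ C ∧ ∀ d ∈ C,
      LexGe i₀ C.card (fun i => (stageWeight B V i x : ℤ)) fun i => (stageWeight B V i d : ℤ) := by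
    intro x
    rw [sksWinners, dif_pos hne]
    exact sksFrom_eq hB hmB him C x
  have hscore : ∀ x ∈ sksWinners C V, maj V ≤ score V i₀ x := by
    intro x hx
    have h := ((lexGe_iff_succ him).1 (((hmem x).1 hx).2 e he)).1
    exact hemaj.trans (score_le_of_stageWeight_le hB hmB him (by exact_mod_cast h))
  constructor
  · intro h
    have hnonempty : (sksWinners C V).Nonempty := by
      obtain ⟨x, hx, hmax⟩ := C.exists_max_image
        (fun x => lexKey i₀ C.card fun i => (stageWeight B V i x : ℤ)) ⟨c, hc⟩
      exact ⟨x, (hmem x).2 ⟨hx, fun d hd => lexKey_le_iff.1 (hmax d hd)⟩⟩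
    obtain ⟨d, hd, hdc⟩ : ∃ d ∈ sksWinners C V, d ≠ c := by
      by_contra! hall
      exact h (hnonempty.subset_singleton_iff.1 fun x hx => Finset.mem_singleton.2 (hall x hx))
    refine ⟨d, ((hmem d).1 hd).1, hdc, i₀, hi1, him, ?_, (hmaj _).1 (hscore d hd),
      ((hmem d).1 hd).2 c hc⟩
    by_contra hlt
    rcases hi1.eq_or_lt with h1 | h1
    · rw [← h1, Nat.sub_self, score_zero] at hlt
      lia
    · have := hmin (i₀ - 1) (by lia) (by lia) c hc ((hmaj _).2 (by lia))
      lia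
  · rintro ⟨d, hd, hdc, i, h1, h2, h3, h4, h5⟩ heq
    have hcw : c ∈ sksWinners C V := heq ▸ Finset.mem_singleton_self c
    have hle := hmin i h1 h2 d hd ((hmaj _).2 h4)
    rcases hle.eq_or_lt with rfl | hlt
    · have hdw : d ∈ sksWinners C V :=
        (hmem d).2 ⟨hd, fun y hy => h5.trans (((hmem c).1 hcw).2 y hy)⟩
      rw [heq] at hdw
      exact hdc (Finset.mem_singleton.1 hdw)
    · have h6 := (hmaj _).1 (hscore c hcw)
      have h7 := score_mono V (show i₀ ≤ i - 1 by lia) c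
      lia

/-- Without votes, all candidates win. -/
theorem sksWinners_nil (C : Finset α) : sksWinners C [] = C := by
  have : ¬ (majStages C ([] : List (List α))).Nonempty := by
    rintro ⟨i, hi⟩
    obtain ⟨-, c, -, h⟩ := Finset.mem_filter.1 hi
    simp [maj, score] at h
  rw [sksWinners, dif_neg this]

end Winners

/-! ### Sublists and sets of indices -/

theorem List.Sublist.exists_finset {β : Type*} {l' l : List β} (h : l'.Sublist l) (b : β) :
    ∃ A ⊆ Finset.range l.length, A.card = l'.length ∧
      ∀ f : β → ℕ, (l'.map f).sum = ∑ u ∈ A, f (l.getD u b) := by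
  induction h with
  | slnil => exact ⟨∅, by simp, rfl, fun f => rfl⟩
  | @cons l₁ l₂ a _ ih =>
    obtain ⟨A, hA, hc, hf⟩ := ih
    refine ⟨A.map ⟨Nat.succ, Nat.succ_injective⟩, fun x hx => ?_, by simpa using hc, fun f => ?_⟩
    · obtain ⟨y, hy, rfl⟩ := Finset.mem_map.1 hx
      have := Finset.mem_range.1 (hA hy)
      simpa using this
    · simp [hf]
  | @cons_cons l₁ l₂ a _ ih =>
    obtain ⟨A, hA, hc, hf⟩ := ih
    have h0 : 0 ∉ A.map ⟨Nat.succ, Nat.succ_injective⟩ := by simp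
    refine ⟨insert 0 (A.map ⟨Nat.succ, Nat.succ_injective⟩), fun x hx => ?_, ?_, fun f => ?_⟩
    · rcases Finset.mem_insert.1 hx with rfl | hx
      · simp
      · obtain ⟨y, hy, rfl⟩ := Finset.mem_map.1 hx
        have := Finset.mem_range.1 (hA hy)
        simpa using this
    · rw [Finset.card_insert_of_notMem h0]
      simpa using hc
    · rw [Finset.sum_insert h0]
      simp [hf]

theorem List.exists_sublist_of_finset {β : Type*} (l : List β) (b : β) {A : Finset ℕ}
    (hA : A ⊆ Finset.range l.length) :
    ∃ l' : List β, l'.Sublist l ∧ A.card = l'.length ∧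
      ∀ f : β → ℕ, (l'.map f).sum = ∑ u ∈ A, f (l.getD u b) := by
  have hl : (List.range l.length).map (fun u => l.getD u b) = l := by
    refine List.ext_getElem (by simp) fun i h1 h2 => ?_
    simp [h2]
  have hA' : ((List.range l.length).filter (· ∈ A)).toFinset = A := by
    ext x
    simp only [List.toFinset_filter, decide_eq_true_eq, Finset.mem_filter, List.mem_toFinset,
      List.mem_range, and_iff_right_iff_imp]
    exact fun hx => Finset.mem_range.1 (hA hx)
  have hnd : ((List.range l.length).filter (· ∈ A)).Nodup := List.nodup_range.filter _
  refine ⟨((List.range l.length).filter (· ∈ A)).map fun u => l.getD u b, ?_, ?_, fun f => ?_⟩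
  · conv_rhs => rw [← hl]
    exact List.filter_sublist.map _
  · rw [List.length_map, ← List.toFinset_card_of_nodup hnd, hA']
  · rw [List.map_map, ← List.sum_toFinset _ hnd, hA']
    rfl

/-! ### Elections given by tables of positions -/

section Table

variable (p : ℕ → ℕ → ℕ) (nV nU B m c d i : ℕ)

/-- The contribution of vote `r` to the stage weight of candidate `a`. Here and below, `p r a` is
the position of `a` in vote `r`; the votes `r < nV` are registered, the votes `nV + u` with `u < nU`
are not. -/
def voteWeight (j r a : ℕ) : ℕ := if p r a ≤ j then B - p r a else 0

/-- The score of `a` in stage `j`, if the unregistered votes with indices in `A` are added. -/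
def tableScore (A : Finset ℕ) (j a : ℕ) : ℕ :=
  ∑ r ∈ Finset.range nV, (if p r a ≤ j then 1 else 0) +
    ∑ u ∈ A, if p (nV + u) a ≤ j then 1 else 0

/-- The stage weight of `a`, if the unregistered votes with indices in `A` are added. -/
def tableWeight (A : Finset ℕ) (j a : ℕ) : ℕ :=
  ∑ r ∈ Finset.range nV, voteWeight p B j r a + ∑ u ∈ A, voteWeight p B j (nV + u) a

/-- With the votes in `A` added, `d` prevents `c` from being the unique winner, in stage `i`. -/
def Spoils (A : Finset ℕ) : Prop :=
  2 * tableScore p nV A (i - 1) c ≤ nV + A.card ∧ nV + A.card < 2 * tableScore p nV A i d ∧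
    LexGe i m (fun j => (tableWeight p nV B A j d : ℤ)) fun j => (tableWeight p nV B A j c : ℤ)

/-- The class of an unregistered vote: whether `c` is ranked before position `i`, and whether `d` is
among the top `i` positions. -/
def voteClass (u : ℕ) : ℕ :=
  2 * (if p (nV + u) c ≤ i - 1 then 1 else 0) + if p (nV + u) d ≤ i then 1 else 0

/-- The advantage of `d` over `c` that an unregistered vote yields in the several stages. -/
def advantage (u : ℕ) : ℕ → ℤ :=
  fun j => (voteWeight p B j (nV + u) d : ℤ) - voteWeight p B j (nV + u) c

/-- The greedy choice of unregistered votes: `q t` votes from every class `t`, with the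
lexicographically largest advantages. -/
noncomputable def bestVotes (q : ℕ → ℕ) : Finset ℕ :=
  greedy nU (voteClass p nV c d i) (fun u => lexKey i m (advantage p nV B c d u)) q

variable {p nV nU B m c d i}

/-- The greedy choice with the class sizes of `A` is as good as `A`: the class sizes determine the
two scores, and the sum of the advantages is the largest one possible. -/
theorem Spoils.bestVotes {A : Finset ℕ} (hA : A ⊆ Finset.range nU)
    (h : Spoils p nV B m c d i A) {q : ℕ → ℕ}
    (hq : ∀ t, q t = (A.filter fun u => voteClass p nV c d i u = t).card) :
    (_root_.bestVotes p nV nU B m c d i q).card = A.card ∧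
      Spoils p nV B m c d i (_root_.bestVotes p nV nU B m c d i q) := by
  obtain ⟨hh, hsum⟩ := sum_le_sum_greedy (key := fun u => lexKey i m (advantage p nV B c d u)) hA hq
  set G := _root_.bestVotes p nV nU B m c d i q with hG
  rw [← _root_.bestVotes, ← hG] at hsum
  replace hh : ∀ h : ℕ → ℕ, ∑ u ∈ G, h (voteClass p nV c d i u) =
      ∑ u ∈ A, h (voteClass p nV c d i u) := hh
  have hcard : G.card = A.card := by simpa using hh fun _ => 1
  have hc : tableScore p nV G (i - 1) c = tableScore p nV A (i - 1) c := by
    have e : ∀ u, (if p (nV + u) c ≤ i - 1 then 1 else 0) = voteClass p nV c d i u / 2 := by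
      intro u
      unfold voteClass
      split_ifs <;> rfl
    simp only [tableScore, e]
    exact congrArg _ (hh (· / 2))
  have hd : tableScore p nV G i d = tableScore p nV A i d := by
    have e : ∀ u, (if p (nV + u) d ≤ i then 1 else 0) = voteClass p nV c d i u % 2 := by
      intro u
      unfold voteClass
      split_ifs <;> rfl
    simp only [tableScore, e]
    exact congrArg _ (hh (· % 2))
  refine ⟨hcard, by rw [hc, hcard]; exact h.1, by rw [hd, hcard]; exact h.2.1, ?_⟩
  have key : ∀ S : Finset ℕ, lexKey i m (fun j => (tableWeight p nV B S j d : ℤ)) =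
      lexKey i m (fun j => (tableWeight p nV B S j c : ℤ)) +
        (lexKey i m (fun j => ∑ r ∈ Finset.range nV,
          ((voteWeight p B j r d : ℤ) - voteWeight p B j r c)) +
        ∑ u ∈ S, lexKey i m (advantage p nV B c d u)) := by
    intro S
    rw [← lexKey_sum, ← lexKey_add, ← lexKey_add]
    congr 1
    funext j
    simp only [tableWeight, advantage, Finset.sum_sub_distrib]
    push_cast
    ring
  have h3 := lexKey_le_iff.2 h.2.2
  rw [key A, le_add_iff_nonneg_right] at h3
  rw [← lexKey_le_iff, key G, le_add_iff_nonneg_right]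
  exact h3.trans (by gcongr)

/-- The function with the values `a`, `b`, `e`, `f` at `0`, `1`, `2`, and from `3` on. -/
def quotas (a b e f t : ℕ) : ℕ := if t = 0 then a else if t = 1 then b else if t = 2 then e else f

/-- Only the greedy choices have to be tried, for all possible class sizes. -/
theorem exists_spoils_iff (k : ℕ) :
    (∃ A ⊆ Finset.range nU, A.card ≤ k ∧ Spoils p nV B m c d i A) ↔
      ∃ q₀ < nU + 1, ∃ q₁ < nU + 1, ∃ q₂ < nU + 1, ∃ q₃ < nU + 1,
        (bestVotes p nV nU B m c d i (quotas q₀ q₁ q₂ q₃)).card ≤ k ∧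
          Spoils p nV B m c d i (bestVotes p nV nU B m c d i (quotas q₀ q₁ q₂ q₃)) := by
  constructor
  · rintro ⟨A, hA, hk, h⟩
    let q : ℕ → ℕ := fun t => (A.filter fun u => voteClass p nV c d i u = t).card
    have hq : ∀ t, q t < nU + 1 := fun t => Nat.lt_succ_of_le
      ((Finset.card_filter_le _ _).trans ((Finset.card_le_card hA).trans (by simp)))
    refine ⟨q 0, hq 0, q 1, hq 1, q 2, hq 2, q 3, hq 3, ?_⟩
    have hq4 : quotas (q 0) (q 1) (q 2) (q 3) =
        fun t => if t < 4 then q t else q 3 := by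
      funext t
      rcases t with _ | _ | _ | _ | t <;> simp [quotas]
    have hb : bestVotes p nV nU B m c d i (quotas (q 0) (q 1) (q 2) (q 3)) =
        bestVotes p nV nU B m c d i q := by
      rw [hq4]
      unfold bestVotes greedy
      refine Finset.filter_congr fun u _ => ?_
      have : voteClass p nV c d i u < 4 := by
        unfold voteClass
        split_ifs <;> simp
      beta_reduce
      rw [if_pos this]
    rw [hb]
    obtain ⟨h1, h2⟩ := h.bestVotes hA (q := q) fun t => rfl
    exact ⟨h1.trans_le hk, h2⟩
  · rintro ⟨q₀, -, q₁, -, q₂, -, q₃, -, h1, h2⟩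
    exact ⟨_, Finset.filter_subset _ _, h1, h2⟩

end Table

/-! ### Control by adding voters -/

/-- The position of the candidate with index `a` in the vote with index `r`, where the unregistered
votes follow the registered ones. -/
def ControlData.position (I : ControlData) (r a : ℕ) : ℕ :=
  pos ((I.votes ++ I.unreg).getD r []) (I.cands.getD a 0)

theorem pos_le_of_perm {α : Type} [DecidableEq α] {v C : List α} (h : v.Perm C) {a : α}
    (ha : a ∈ C) : pos v a ≤ C.length := by
  rw [pos, ← h.length_eq]
  exact List.idxOf_lt_length_of_mem (h.mem_iff.2 ha)

theorem List.sum_map_eq_sum_range_getD {β : Type*} (l : List β) (b : β) (f : β → ℕ) :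
    (l.map f).sum = ∑ u ∈ Finset.range l.length, f (l.getD u b) := by
  induction l with
  | nil => rfl
  | cons a l ih => simp [Finset.sum_range_succ', ih, add_comm]

/-- The answer to the control problem in terms of the table of positions. If there are no votes at
all, every candidate wins. -/
theorem destructiveAddVoters_iff {I : ControlData} (hI : I.IsInstance) {c : ℕ}
    (hc : c < I.cands.length) (hct : I.cands.getD c 0 = I.target) {B : ℕ}
    (hB : (I.votes.length + I.unreg.length) * I.cands.length < B) (hmB : I.cands.length ≤ B) :
    I.DestructiveAddVoters sksWinners ↔
      (I.votes.length = 0 ∧ 2 ≤ I.cands.length) ∨ ∃ d < I.cands.length, d ≠ c ∧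
        ∃ i < I.cands.length + 1, 1 ≤ i ∧ ∃ A ⊆ Finset.range I.unreg.length, A.card ≤ I.limit ∧
          Spoils I.position I.votes.length B I.cands.length c d i A := by
  obtain ⟨hnd, hV, hU, ht⟩ := hI
  have hcard : I.cands.toFinset.card = I.cands.length := List.toFinset_card_of_nodup hnd
  -- The scores and weights of the election with additional votes.
  have hsum : ∀ (U : List (List ℕ)) (A : Finset ℕ), A ⊆ Finset.range I.unreg.length →
      (∀ f : List ℕ → ℕ, (U.map f).sum = ∑ u ∈ A, f (I.unreg.getD u [])) →
      ∀ f : List ℕ → ℕ, ((I.votes ++ U).map f).sum =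
        ∑ r ∈ Finset.range I.votes.length, f ((I.votes ++ I.unreg).getD r []) +
          ∑ u ∈ A, f ((I.votes ++ I.unreg).getD (I.votes.length + u) []) := by
    intro U A hA hf f
    rw [List.map_append, List.sum_append, hf, List.sum_map_eq_sum_range_getD _ []]
    congr 1
    · refine Finset.sum_congr rfl fun r hr => ?_
      rw [List.getD_append _ _ _ _ (Finset.mem_range.1 hr)]
    · refine Finset.sum_congr rfl fun u hu => ?_
      rw [List.getD_append_right _ _ _ _ (by lia), Nat.add_sub_cancel_left]
  have hscore : ∀ (U : List (List ℕ)) (A : Finset ℕ), A ⊆ Finset.range I.unreg.length →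
      (∀ f : List ℕ → ℕ, (U.map f).sum = ∑ u ∈ A, f (I.unreg.getD u [])) → ∀ j a,
      score (I.votes ++ U) j (I.cands.getD a 0) = tableScore I.position I.votes.length A j a ∧
      stageWeight B (I.votes ++ U) j (I.cands.getD a 0) =
        tableWeight I.position I.votes.length B A j a :=
    fun U A hA hf j a => ⟨hsum U A hA hf _, hsum U A hA hf _⟩
  -- The criterion for a single election.
  have hiff : ∀ (U : List (List ℕ)) (A : Finset ℕ), A ⊆ Finset.range I.unreg.length →
      A.card = U.length → U.Sublist I.unreg →
      (∀ f : List ℕ → ℕ, (U.map f).sum = ∑ u ∈ A, f (I.unreg.getD u [])) → I.votes ++ U ≠ [] →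
      (sksWinners I.cands.toFinset (I.votes ++ U) ≠ {I.target} ↔ ∃ d < I.cands.length, d ≠ c ∧
        ∃ i < I.cands.length + 1, 1 ≤ i ∧
          Spoils I.position I.votes.length B I.cands.length c d i A) := by
    intro U A hA hAU hUs hf hne
    have hlenU : U.length ≤ I.unreg.length := hUs.length_le
    rw [sksWinners_ne_singleton_iff (B := B) hne ?_ ?_ (by rwa [hcard]) (List.mem_toFinset.2 ht),
      hcard]
    · have hs := hscore U A hA hf
      have hlen : (I.votes ++ U).length = I.votes.length + A.card := by
        rw [List.length_append, hAU]
      rw [hlen]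
      constructor
      · rintro ⟨d, hd, hdc, i, h1, h2, h3, h4, h5⟩
        obtain ⟨d, hdm, rfl⟩ := List.getElem_of_mem (List.mem_toFinset.1 hd)
        rw [← List.getD_eq_getElem _ 0 hdm] at hdc h4 h5
        rw [← hct] at hdc h3 h5
        refine ⟨d, hdm, fun h => hdc (by rw [h]), i, by lia, h1, ?_, ?_, ?_⟩
        · rwa [← (hs _ _).1]
        · rwa [← (hs _ _).1]
        · simpa only [(hs _ _).2] using h5
      · rintro ⟨d, hdm, hdc, i, h1, h2, h3, h4, h5⟩
        refine ⟨I.cands.getD d 0, ?_, ?_, i, h2, by lia, ?_, ?_, ?_⟩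
        · rw [List.getD_eq_getElem _ 0 hdm]
          exact List.mem_toFinset.2 (List.getElem_mem hdm)
        · rw [← hct, List.getD_eq_getElem _ 0 hdm, List.getD_eq_getElem _ 0 hc]
          exact fun h => hdc ((hnd.getElem_inj_iff).1 h)
        · rwa [← hct, (hs _ _).1]
        · rwa [(hs _ _).1]
        · rw [← hct]
          simpa only [(hs _ _).2] using h5
    · intro v hv a ha
      rw [hcard]
      refine pos_le_of_perm ?_ (List.mem_toFinset.1 ha)
      rcases List.mem_append.1 hv with hv | hv
      · exact hV v hv
      · exact hU v (hUs.subset hv)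
    · rw [hcard]
      refine lt_of_le_of_lt (Nat.mul_le_mul_right _ ?_) hB
      rw [List.length_append]
      lia
  constructor
  · rintro ⟨U, hUs, hk, h⟩
    by_cases hne : I.votes ++ U = []
    · left
      rw [hne, sksWinners_nil] at h
      have hnil := List.append_eq_nil_iff.1 hne
      refine ⟨by rw [hnil.1]; rfl, ?_⟩
      by_contra hlt
      refine h (Finset.eq_singleton_iff_unique_mem.2 ⟨List.mem_toFinset.2 ht, ?_⟩)
      have h1 : I.cands.toFinset.card ≤ 1 := by lia
      exact fun x hx => Finset.card_le_one.1 h1 x hx _ (List.mem_toFinset.2 ht)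
    · right
      obtain ⟨A, hA, hAU, hf⟩ := hUs.exists_finset []
      obtain ⟨d, hd, hdc, i, h1, h2, h3⟩ := (hiff U A hA hAU hUs hf hne).1 h
      exact ⟨d, hd, hdc, i, h1, h2, A, hA, hAU.trans_le hk, h3⟩
  · rintro (⟨h1, h2⟩ | ⟨d, hd, hdc, i, h1, h2, A, hA, hk, h3⟩)
    · refine ⟨[], List.nil_sublist _, Nat.zero_le _, fun h => ?_⟩
      rw [List.length_eq_zero_iff.1 h1, List.append_nil, sksWinners_nil] at h
      have := congrArg Finset.card h
      rw [hcard, Finset.card_singleton] at this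
      lia
    · obtain ⟨U, hUs, hAU, hf⟩ := I.unreg.exists_sublist_of_finset [] hA
      refine ⟨U, hUs, hAU ▸ hk, (hiff U A hA hAU hUs hf fun hnil => ?_).2
        ⟨d, hd, hdc, i, h1, h2, h3⟩⟩
      have h4 := h3.2.1
      rw [← (hscore U A hA hf i d).1, hnil] at h4
      simp [score] at h4

/-! ### While programs on an input word and counters -/

/-- The memory of a while program: the part of the input word in front of the reading head (`inp`),
the part that the head has passed, nearest symbol first (`aux`), and the counters. -/
structure Store where
  inp : List Γ'
  aux : List Γ'
  reg : ℕ → ℕ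

/-- The elementary instructions. Moving the head beyond an end of the word has no effect, and
decrementing a counter stops at zero. -/
inductive Instr
  | inc (r : ℕ)
  | dec (r : ℕ)
  | moveRight
  | moveLeft
  | drop
  | probe (a : Γ') (r : ℕ)

/-- The effect of an instruction. `drop` deletes the symbol under the head, and `probe a r`
increments counter `r` if this symbol is `a`. -/
def Instr.run : Instr → Store → Store
  | inc r, s => { s with reg := Function.update s.reg r (s.reg r + 1) }
  | dec r, s => { s with reg := Function.update s.reg r (s.reg r - 1) }
  | moveRight, s => { s with inp := s.inp.tail, aux := s.inp.head?.toList ++ s.aux }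
  | moveLeft, s => { s with aux := s.aux.tail, inp := s.aux.head?.toList ++ s.inp }
  | drop, s => { s with inp := s.inp.tail }
  | probe a r, s =>
    if s.inp.head? = some a then { s with reg := Function.update s.reg r (s.reg r + 1) } else s

/-- The loop conditions: a counter is positive, or the head is not at the end of the word. -/
inductive Test
  | pos (r : ℕ)
  | more

def Test.holds : Test → Store → Prop
  | pos r, s => s.reg r ≠ 0
  | more, s => s.inp ≠ []

/-- While programs. -/
inductive Cmd
  | instr (i : Instr)
  | seq (c d : Cmd)
  | loop (t : Test) (c : Cmd)

/-- `Exec c s s' t`: started with memory `s`, the program `c` stops after `t` steps with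
memory `s'`. -/
inductive Exec : Cmd → Store → Store → ℕ → Prop
  | instr (i s) : Exec (.instr i) s (i.run s) 1
  | seq {c d s₁ s₂ s₃ t₁ t₂} : Exec c s₁ s₂ t₁ → Exec d s₂ s₃ t₂ → Exec (.seq c d) s₁ s₃ (t₁ + t₂)
  | done {b c s} : ¬ b.holds s → Exec (.loop b c) s s 1
  | again {b c s₁ s₂ s₃ t₁ t₂} : b.holds s₁ → Exec c s₁ s₂ t₁ → Exec (.loop b c) s₂ s₃ t₂ →
      Exec (.loop b c) s₁ s₃ (1 + t₁ + t₂)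

/-! ### Compilation to multi-stack Turing machines -/

/-- The stacks of the machine for a program that uses the counters up to `N`. -/
inductive Stack (N : ℕ)
  | inp
  | aux
  | out
  | reg (r : Fin (N + 1))
  deriving DecidableEq, Fintype

/-- The stack alphabets; a counter is a stack over a one-letter alphabet. -/
@[reducible] def Stack.Alph {N : ℕ} : Stack N → Type
  | inp => Γ'
  | aux => Γ'
  | out => Bool
  | reg _ => Unit

/-- The stack of counter `r`; it is only used for `r ≤ N`. -/
def Stack.ofNat (N r : ℕ) : Stack N := .reg (Fin.ofNat (N + 1) r)

/-- The stack contents that represent a memory. -/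
def Store.toStk (N : ℕ) (s : Store) : ∀ k : Stack N, List k.Alph
  | .inp => s.inp
  | .aux => s.aux
  | .out => []
  | .reg r => List.replicate (s.reg r) ()

/-- Statements of the machine over the label type `Λ`. The internal state holds the symbol that was
read last; it is `none` whenever a statement starts. -/
abbrev MStmt (N : ℕ) (Λ : Type) : Type := Turing.TM2.Stmt (Stack.Alph (N := N)) Λ (Option Γ')

section Compile

variable (N : ℕ) {Λ : Type}

open Turing.TM2.Stmt in
/-- The statement that executes an instruction and then `q`. The default `Γ'.blank` is never used:
the internal state is not `none` in that branch. -/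
def Instr.stmt (q : MStmt N Λ) : Instr → MStmt N Λ
  | inc r => push (Stack.ofNat N r) (fun _ => ()) q
  | dec r => pop (Stack.ofNat N r) (fun v _ => v) q
  | moveRight => pop .inp (fun _ (o : Option Γ') => o)
      (branch Option.isSome
        (push .aux (fun v => (v.getD Γ'.blank : Γ')) (load (fun _ => none) q)) q)
  | moveLeft => pop .aux (fun _ (o : Option Γ') => o)
      (branch Option.isSome
        (push .inp (fun v => (v.getD Γ'.blank : Γ')) (load (fun _ => none) q)) q)
  | drop => pop .inp (fun v _ => v) q
  | probe a r => peek .inp (fun _ (o : Option Γ') => o)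
      (branch (fun v => decide (v = some a))
        (push (Stack.ofNat N r) (fun _ => ()) (load (fun _ => none) q)) (load (fun _ => none) q))

open Turing.TM2.Stmt in
/-- The statement that continues with `q` or `q'`, according to a loop condition. -/
def Test.stmt (q q' : MStmt N Λ) : Test → MStmt N Λ
  -- In the internal state, `blank` only signals that the counter is not zero.
  | pos r => peek (Stack.ofNat N r) (fun _ (o : Option Unit) => o.map fun _ => Γ'.blank)
      (branch Option.isSome (load (fun _ => none) q) q')
  | more => peek .inp (fun _ (o : Option Γ') => o)
      (branch Option.isSome (load (fun _ => none) q) q')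

/-- The labels of a program: one for each instruction and each loop. -/
def Cmd.Lab : Cmd → Type
  | instr _ => Unit
  | seq c d => c.Lab ⊕ d.Lab
  | loop _ c => Option c.Lab

/-- The label at which a program starts. -/
def Cmd.entry : (c : Cmd) → c.Lab
  | instr _ => ()
  | seq c _ => Sum.inl c.entry
  | loop _ _ => none

instance Cmd.fintypeLab : (c : Cmd) → Fintype c.Lab
  | instr _ => inferInstanceAs (Fintype Unit)
  | seq c d =>
    have := c.fintypeLab
    have := d.fintypeLab
    inferInstanceAs (Fintype (c.Lab ⊕ d.Lab))
  | loop _ c =>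
    have := c.fintypeLab
    inferInstanceAs (Fintype (Option c.Lab))

open Turing.TM2.Stmt in
/-- The statements of a program inside of a machine, into whose labels the labels of the program are
embedded by `emb`. The program continues at `next`. -/
def Cmd.compile : (c : Cmd) → (c.Lab → Λ) → Λ → c.Lab → MStmt N Λ
  | instr i, _, next, _ => i.stmt N (goto fun _ => next)
  | seq c d, emb, _, .inl l => c.compile (fun x => emb (.inl x)) (emb (.inr d.entry)) l
  | seq _ d, emb, next, .inr l => d.compile (fun x => emb (.inr x)) next l
  | loop b c, emb, next, none =>
    b.stmt N (goto fun _ => emb (some c.entry)) (goto fun _ => next)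
  | loop _ c, emb, _, some l => c.compile (fun x => emb (some x)) (emb none) l

/-- All counters in the program are at most `N`. -/
def Cmd.RegLE : Cmd → Prop
  | instr (.inc r) | instr (.dec r) | instr (.probe _ r) => r ≤ N
  | instr _ => True
  | seq c d => c.RegLE ∧ d.RegLE
  | loop (.pos r) c => r ≤ N ∧ c.RegLE
  | loop .more c => c.RegLE

variable {N}

theorem Cmd.RegLE.mono {M : ℕ} (h : N ≤ M) {c : Cmd} (hc : c.RegLE N) : c.RegLE M := by
  induction c with
  | instr i => cases i <;> first | exact le_trans hc h | trivial
  | seq c d ihc ihd => exact ⟨ihc hc.1, ihd hc.2⟩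
  | loop t c ih =>
    cases t with
    | pos r => exact ⟨le_trans hc.1 h, ih hc.2⟩
    | more => exact ih hc

theorem Cmd.exists_regLE (c : Cmd) : ∃ N, c.RegLE N := by
  induction c with
  | instr i => cases i <;> first | exact ⟨_, le_rfl⟩ | exact ⟨0, trivial⟩
  | seq c d hc hd =>
    obtain ⟨M, hM⟩ := hc
    obtain ⟨M', hM'⟩ := hd
    exact ⟨max M M', hM.mono (le_max_left _ _), hM'.mono (le_max_right _ _)⟩
  | loop t c hc =>
    obtain ⟨M, hM⟩ := hc
    cases t with
    | pos r => exact ⟨max r M, le_max_left _ _, hM.mono (le_max_right _ _)⟩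
    | more => exact ⟨M, hM⟩

theorem Store.toStk_update_reg (s : Store) {r : ℕ} (hr : r ≤ N) (n : ℕ) :
    Function.update (s.toStk N) (Stack.ofNat N r) (List.replicate n ()) =
      ({ s with reg := Function.update s.reg r n } : Store).toStk N := by
  funext k
  have hv : ((Fin.ofNat (N + 1) r : Fin (N + 1)) : ℕ) = r := by
    simp [Nat.mod_eq_of_lt (Nat.lt_succ_of_le hr)]
  by_cases h : k = Stack.ofNat N r
  · subst h
    rw [Function.update_self]
    simp only [Stack.ofNat, toStk, hv, Function.update_self]
  · rw [Function.update_of_ne h]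
    rcases k with _ | _ | _ | k <;> try rfl
    have : (k : ℕ) ≠ r := fun e => h (by rw [Stack.ofNat]; congr 1; exact Fin.ext (e.trans hv.symm))
    simp [toStk, Function.update_of_ne this]

theorem Store.toStk_ofNat (s : Store) {r : ℕ} (hr : r ≤ N) :
    s.toStk N (Stack.ofNat N r) = List.replicate (s.reg r) () := by
  have h := congrFun (s.toStk_update_reg hr (s.reg r)) (Stack.ofNat N r)
  rw [Function.update_self, Function.update_eq_self] at h
  exact h.symm

theorem Store.toStk_update_inp (s : Store) (l : List Γ') :
    Function.update (s.toStk N) .inp l = ({ s with inp := l } : Store).toStk N := by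
  funext k
  rcases k with _ | _ | _ | k <;> rfl

theorem Store.toStk_update_aux (s : Store) (l : List Γ') :
    Function.update (s.toStk N) .aux l = ({ s with aux := l } : Store).toStk N := by
  funext k
  rcases k with _ | _ | _ | k <;> rfl

open Turing.TM2 in
theorem Instr.stepAux_stmt (i : Instr) (hi : (Cmd.instr i).RegLE N) (q : MStmt N Λ) (s : Store) :
    stepAux (i.stmt N q) none (s.toStk N) = stepAux q none ((i.run s).toStk N) := by
  rcases s with ⟨inp, aux, reg⟩
  cases i with
  | inc r =>
    simp only [Instr.stmt, stepAux, Store.toStk_ofNat _ hi]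
    exact congrArg (stepAux q none) (Store.toStk_update_reg _ hi (reg r + 1))
  | dec r =>
    simp only [Instr.stmt, stepAux, Store.toStk_ofNat _ hi]
    have h : (List.replicate (reg r) ()).tail = List.replicate (reg r - 1) () :=
      List.tail_replicate
    refine (congrArg (fun l => stepAux q none (Function.update _ (Stack.ofNat N r) l)) h).trans ?_
    exact congrArg (stepAux q none) (Store.toStk_update_reg _ hi (reg r - 1))
  | moveRight =>
    cases inp with
    | nil => exact congrArg (stepAux q none) (Store.toStk_update_inp _ [])
    | cons a l =>
      simp only [Instr.stmt, stepAux]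
      erw [Store.toStk_update_inp, Store.toStk_update_aux]
      rfl
  | moveLeft =>
    cases aux with
    | nil => exact congrArg (stepAux q none) (Store.toStk_update_aux _ [])
    | cons a l =>
      simp only [Instr.stmt, stepAux]
      erw [Store.toStk_update_aux, Store.toStk_update_inp]
      rfl
  | drop =>
    simp only [Instr.stmt, stepAux]
    erw [Store.toStk_update_inp]
    rfl
  | probe a r =>
    simp only [Instr.stmt, stepAux, Instr.run]
    change cond (decide (inp.head? = some a)) _ _ = _
    by_cases h : inp.head? = some a
    · simp only [h, decide_true, cond_true, if_true, Store.toStk_ofNat _ hi]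
      exact congrArg (stepAux q none) (Store.toStk_update_reg _ hi (reg r + 1))
    · simp [h]

open Turing.TM2 in
theorem Test.stepAux_stmt (b : Test) (hb : ∀ r, b = .pos r → r ≤ N) (q q' : MStmt N Λ)
    (s : Store) : (b.holds s → stepAux (b.stmt N q q') none (s.toStk N) =
        stepAux q none (s.toStk N)) ∧
      (¬ b.holds s → stepAux (b.stmt N q q') none (s.toStk N) =
        stepAux q' none (s.toStk N)) := by
  rcases s with ⟨inp, aux, reg⟩
  cases b with
  | pos r =>
    simp only [Test.stmt, stepAux, Test.holds, Store.toStk_ofNat _ (hb r rfl)]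
    cases h : reg r with
    | zero => exact ⟨fun h => absurd rfl h, fun _ => rfl⟩
    | succ n => exact ⟨fun _ => rfl, fun h => absurd n.succ_ne_zero h⟩
  | more =>
    simp only [Test.stmt, stepAux, Test.holds]
    cases inp with
    | nil => exact ⟨fun h => absurd rfl h, fun _ => rfl⟩
    | cons a l => exact ⟨fun _ => rfl, fun h => absurd (List.cons_ne_nil a l) h⟩

/-- `t` machine steps lead from the configuration `a` to `b`. -/
def StepsTo (M : Λ → MStmt N Λ) (t : ℕ) (a b : Turing.TM2.Cfg (Stack.Alph (N := N)) Λ (Option Γ')) :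
    Prop :=
  (flip bind (Turing.TM2.step M))^[t] (some a) = some b

theorem StepsTo.trans {M : Λ → MStmt N Λ} {t t' : ℕ}
    {a b c : Turing.TM2.Cfg (Stack.Alph (N := N)) Λ (Option Γ')} (h : StepsTo M t a b)
    (h' : StepsTo M t' b c) : StepsTo M (t + t') a c := by
  unfold StepsTo at *
  rw [Nat.add_comm, Function.iterate_add_apply, h, h']

/-- The compiled program simulates the execution of the program, step by step. -/
theorem Exec.stepsTo {c : Cmd} {s s' : Store} {t : ℕ} (h : Exec c s s' t) (hc : c.RegLE N)
    (M : Λ → MStmt N Λ) (emb : c.Lab → Λ) (next : Λ)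
    (hM : ∀ l, M (emb l) = c.compile N emb next l) :
    StepsTo M t ⟨some (emb c.entry), none, s.toStk N⟩ ⟨some next, none, s'.toStk N⟩ := by
  induction h generalizing next with
  | instr i s =>
    change some (Turing.TM2.stepAux (M _) _ _) = _
    rw [hM]
    exact congrArg some (Instr.stepAux_stmt i hc _ s)
  | seq h₁ h₂ ih₁ ih₂ =>
    exact (ih₁ hc.1 _ _ fun l => hM (.inl l)).trans (ih₂ hc.2 _ _ fun l => hM (.inr l))
  | @done b c s hb =>
    have hr : ∀ r, b = .pos r → r ≤ N := by rintro r rfl; exact hc.1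
    change some (Turing.TM2.stepAux (M _) _ _) = _
    rw [hM]
    exact congrArg some ((Test.stepAux_stmt b hr _ _ s).2 hb)
  | @again b c s₁ s₂ s₃ t₁ t₂ hb h₁ h₂ ih₁ ih₂ =>
    have hr : (∀ r, b = .pos r → r ≤ N) ∧ c.RegLE N := by
      cases b with
      | pos r => exact ⟨by rintro _ ⟨⟩; exact hc.1, hc.2⟩
      | more => exact ⟨by rintro _ ⟨⟩, hc⟩
    refine StepsTo.trans (StepsTo.trans (b := ⟨some (emb (some c.entry)), none, s₁.toStk N⟩) ?_
      (ih₁ hr.2 _ _ fun l => hM (some l))) (ih₂ hc _ _ hM)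
    change some (Turing.TM2.stepAux (M _) _ _) = _
    rw [hM]
    exact congrArg some ((Test.stepAux_stmt b hr.1 _ _ s₁).1 hb)

end Compile

open Turing.TM2.Stmt in
/-- The machine for a program: after the program, it writes the answer, whether counter `0` is
positive, and halts. -/
def Cmd.machine (c : Cmd) (N : ℕ) : Turing.FinTM2 where
  K := Stack N
  k₀ := .inp
  k₁ := .out
  Γ := Stack.Alph
  Λ := Option c.Lab
  main := some c.entry
  σ := Option Γ'
  initialState := none
  Γk₀Fin := inferInstanceAs (Fintype Γ')
  m
    | some l => c.compile N some none l
    | none => pop (Stack.ofNat N 0) (fun _ (o : Option Unit) => o.map fun _ => Γ'.blank)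
        (push .out (fun v => v.isSome) (load (fun _ => none) halt))

/-- A language is in P if a while program decides it in polynomial time. The program has to use up
its input and to leave its answer, `0` or `1`, as the only nonzero counter. -/
theorem InP.of_exec {L : Language Γ'} (f : List Γ' → Bool) (hf : ∀ w, f w = true ↔ w ∈ L) (c : Cmd)
    (k : ℕ) (hc : ∀ w, ∃ t ≤ (w.length + 2) ^ k, Exec c ⟨w, [], fun _ => 0⟩
      ⟨[], [], Function.update (fun _ => 0) 0 (f w).toNat⟩ t) : InP L := by
  obtain ⟨N, hN⟩ := c.exists_regLE
  refine ⟨f, hf, ⟨{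
    tm := c.machine N
    inputAlphabet := Equiv.refl _
    outputAlphabet := Equiv.refl _
    time := (Polynomial.X + 2) ^ k + 1
    outputsFun := fun w => ?_ }⟩⟩
  refine Classical.choice ?_
  obtain ⟨t, ht, h⟩ := hc w
  have h1 := h.stepsTo hN (c.machine N).m some none (fun _ => rfl)
  refine ⟨⟨⟨t + 1, ?_⟩, ?_⟩⟩
  · have h2 : StepsTo (c.machine N).m 1
        ⟨some none, none, (⟨[], [], Function.update (fun _ => 0) 0 (f w).toNat⟩ : Store).toStk N⟩
        (Turing.haltList (c.machine N) [f w]) := by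
      change some (Turing.TM2.stepAux _ _ _) = _
      simp only [Cmd.machine, Turing.TM2.stepAux, Store.toStk_ofNat _ (Nat.zero_le N)]
      erw [List.tail_replicate, Store.toStk_update_reg _ (Nat.zero_le N)]
      simp only [Turing.haltList, Function.update_self, Function.update_idem]
      congr 2
      funext i
      cases hw : f w <;> rcases i with _ | _ | _ | i <;>
        simp [Function.update, Store.toStk] <;> rfl
    have h3 := h1.trans h2
    have h4 : Turing.initList (c.machine N) w =
        ⟨some (some c.entry), none, (⟨w, [], fun _ => 0⟩ : Store).toStk N⟩ := by
      simp only [Turing.initList]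
      congr 1
      funext i
      rcases i with _ | _ | _ | i <;> rfl
    unfold StepsTo at h3
    have h5 : List.map (Equiv.refl Γ').invFun (id w) = w := List.map_id w
    exact (congrArg (fun a => (flip bind (c.machine N).step)^[t + 1] (some a))
      ((congrArg (Turing.initList (c.machine N)) h5).trans h4)).trans h3
  · simpa using ht

/-! ### Running times of while programs -/

/-- Started with memory `s`, the program `c` stops after at most `B` steps with memory `s'`. -/
def ExecLE (c : Cmd) (s s' : Store) (B : ℕ) : Prop := ∃ t ≤ B, Exec c s s' t

theorem ExecLE.mono {c : Cmd} {s s' : Store} {B B' : ℕ} (h : ExecLE c s s' B) (hB : B ≤ B') :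
    ExecLE c s s' B' :=
  let ⟨t, ht, h⟩ := h
  ⟨t, ht.trans hB, h⟩

theorem ExecLE.to {c : Cmd} {s s' s'' : Store} {B : ℕ} (h : ExecLE c s s' B) (e : s' = s'') :
    ExecLE c s s'' B := e ▸ h

theorem ExecLE.instr (i : Instr) (s : Store) : ExecLE (.instr i) s (i.run s) 1 :=
  ⟨1, le_rfl, .instr i s⟩

theorem ExecLE.seq {c d : Cmd} {s₁ s₂ s₃ : Store} {B B' : ℕ} (h : ExecLE c s₁ s₂ B)
    (h' : ExecLE d s₂ s₃ B') : ExecLE (.seq c d) s₁ s₃ (B + B') :=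
  let ⟨_, ht, h⟩ := h
  let ⟨_, ht', h'⟩ := h'
  ⟨_, add_le_add ht ht', .seq h h'⟩

/-- A loop that passes through the memories `S n, S (n - 1), …, S 0`. -/
theorem ExecLE.loop {b : Test} {c : Cmd} (S : ℕ → Store) (B n : ℕ)
    (hb : ∀ j ≤ n, b.holds (S j) ↔ j ≠ 0) (h : ∀ j < n, ExecLE c (S (j + 1)) (S j) B) :
    ExecLE (.loop b c) (S n) (S 0) (n * (B + 1) + 1) := by
  induction n with
  | zero => exact ⟨1, by simp, .done fun h => (hb 0 le_rfl).1 h rfl⟩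
  | succ n ih =>
    obtain ⟨t, ht, h1⟩ := ih (fun j hj => hb j (by lia)) fun j hj => h j (by lia)
    obtain ⟨t', ht', h2⟩ := h n (by lia)
    exact ⟨_, by rw [Nat.succ_mul]; lia,
      .again ((hb (n + 1) le_rfl).2 n.succ_ne_zero) h2 h1⟩

open Function (update)

/-- The program that sets counter `r` to zero. -/
def Cmd.clear (r : ℕ) : Cmd := .loop (.pos r) (.instr (.dec r))

theorem Cmd.execLE_clear (r : ℕ) (u v : List Γ') (s : ℕ → ℕ) :
    ExecLE (clear r) ⟨u, v, s⟩ ⟨u, v, update s r 0⟩ (2 * s r + 1) := by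
  have h := ExecLE.loop (b := .pos r) (c := .instr (.dec r)) (fun j => ⟨u, v, update s r j⟩) 1 (s r)
    (by simp [Test.holds]) fun j _ => by
      have h := ExecLE.instr (.dec r) ⟨u, v, update s r (j + 1)⟩
      simpa [Instr.run] using h
  rw [Function.update_eq_self] at h
  exact h.mono (by lia)

/-- The program that adds counter `r` to counter `r'` and sets `r` to zero. -/
def Cmd.move (r r' : ℕ) : Cmd :=
  .loop (.pos r) (.seq (.instr (.dec r)) (.instr (.inc r')))

theorem Cmd.execLE_move {r r' : ℕ} (hr : r ≠ r') (u v : List Γ') (s : ℕ → ℕ) :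
    ExecLE (move r r') ⟨u, v, s⟩ ⟨u, v, update (update s r 0) r' (s r' + s r)⟩ (3 * s r + 1) := by
  have h := ExecLE.loop (b := .pos r) (c := .seq (.instr (.dec r)) (.instr (.inc r')))
    (fun j => ⟨u, v, update (update s r j) r' (s r' + (s r - j))⟩) 2 (s r)
    (by simp [Test.holds, Function.update_of_ne hr]) fun j hj => by
      have h := ((ExecLE.instr (.dec r)
        ⟨u, v, update (update s r (j + 1)) r' (s r' + (s r - (j + 1)))⟩).seq
          (ExecLE.instr (.inc r') _))
      refine h.to ?_
      simp only [Instr.run]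
      congr 1
      funext i
      simp only [Function.update_apply]
      split_ifs <;> lia
  have h0 : update (update s r (s r)) r' (s r' + (s r - s r)) = s := by simp
  rw [h0] at h
  exact h.mono (by lia)

/-- The program that moves the head to the left, as often as counter `r` says, and sets this counter
to zero. -/
def Cmd.rewind (r : ℕ) : Cmd :=
  .loop (.pos r) (.seq (.instr (.dec r)) (.instr .moveLeft))

/-- The memory in which the head stands at position `q` of the word `w`. -/
def Store.at (w : List Γ') (q : ℕ) (s : ℕ → ℕ) : Store := ⟨w.drop q, (w.take q).reverse, s⟩

theorem Store.at_zero (w : List Γ') (s : ℕ → ℕ) : Store.at w 0 s = ⟨w, [], s⟩ := by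
  simp [Store.at]

theorem Store.moveRight_at (w : List Γ') (q : ℕ) (s : ℕ → ℕ) :
    Instr.moveRight.run (Store.at w (min q w.length) s) = Store.at w (min (q + 1) w.length) s := by
  rcases lt_or_ge q w.length with h | h
  · rw [min_eq_left h.le, min_eq_left h]
    simp [Store.at, Instr.run, List.take_add_one, List.head?_drop]
    cases w[q]? <;> simp
  · rw [min_eq_right h, min_eq_right (by lia)]
    simp [Store.at, Instr.run]

theorem Store.moveLeft_at (w : List Γ') {q : ℕ} (hq : q ≤ w.length) (s : ℕ → ℕ) :
    Instr.moveLeft.run (Store.at w q s) = Store.at w (q - 1) s := by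
  cases q with
  | zero => simp [Store.at, Instr.run]
  | succ q =>
    have h : q < w.length := hq
    have h1 : (w.take (q + 1)).reverse = w[q] :: (w.take q).reverse := by
      rw [List.take_succ_eq_append_getElem h, List.reverse_append]
      rfl
    simp only [Store.at, Instr.run, Nat.add_sub_cancel, h1]
    rw [List.drop_eq_getElem_cons h]
    rfl

theorem Cmd.execLE_rewind (r : ℕ) (w : List Γ') (s : ℕ → ℕ) {q : ℕ} (hq : q ≤ w.length)
    (h : q ≤ s r) :
    ExecLE (rewind r) (Store.at w q s) ⟨w, [], update s r 0⟩ (3 * s r + 1) := by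
  have h := ExecLE.loop (b := .pos r) (c := .seq (.instr (.dec r)) (.instr .moveLeft))
    (fun j => Store.at w (q - (s r - j)) (update s r j)) 2 (s r)
    (by simp [Test.holds, Store.at]) fun j hj => by
      have h := ((ExecLE.instr (.dec r)
        (Store.at w (q - (s r - (j + 1))) (update s r (j + 1)))).seq (ExecLE.instr .moveLeft _))
      have h1 : (Instr.dec r).run (Store.at w (q - (s r - (j + 1))) (update s r (j + 1))) =
          Store.at w (q - (s r - (j + 1))) (update s r j) := by
        simp [Instr.run, Store.at]
      rw [h1, Store.moveLeft_at _ (by lia)] at h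
      rwa [Nat.sub_sub, show s r - (j + 1) + 1 = s r - j by lia] at h
  simp only [Function.update_eq_self, Nat.sub_self, Nat.sub_zero, Nat.sub_eq_zero_of_le ‹_›,
    Store.at_zero] at h
  exact h.mono (by lia)

/-! ### Polynomial bounds -/

/-- Parametrized inputs: a word and `dim` numbers. -/
class Ctx (X : Type) where
  dim : ℕ
  inp : X → List Γ'
  coord : X → ℕ → ℕ

open Ctx (dim inp coord)

instance : Ctx (List Γ') := ⟨0, id, fun _ _ => 0⟩

/-- Every new bound variable adds a last number to the input. -/
instance {X : Type} [Ctx X] : Ctx (X × ℕ) :=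
  ⟨dim X + 1, fun p => inp p.1, fun p i => if i = dim X then p.2 else coord p.1 i⟩

section PolyTime

variable {X Y : Type} [Ctx X] [Ctx Y]

/-- The size of an input: numbers count with their value, as in unary notation. -/
def Ctx.size (x : X) : ℕ := (inp x).length + ∑ i ∈ Finset.range (dim X), coord x i

open Ctx (size)

theorem Ctx.size_prod (x : X) (n : ℕ) : size (x, n) = size x + n := by
  change (inp x).length + ∑ i ∈ Finset.range (dim X + 1), (if i = dim X then n else coord x i) = _
  rw [Finset.sum_range_succ, if_pos rfl, ← add_assoc, size, Finset.sum_congr rfl]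
  intro i hi
  rw [if_neg (Finset.mem_range.1 hi).ne]

/-- `f` is bounded by a polynomial in the size of the input. -/
def PolyBdd (f : X → ℕ) : Prop := ∃ c, ∀ x, f x ≤ (size x + 2) ^ c

theorem PolyBdd.mono {f g : X → ℕ} (hg : PolyBdd g) (h : ∀ x, f x ≤ g x) : PolyBdd f :=
  let ⟨c, hc⟩ := hg
  ⟨c, fun x => (h x).trans (hc x)⟩

theorem PolyBdd.const (n : ℕ) : PolyBdd fun _ : X => n :=
  ⟨n, fun _ => n.lt_two_pow_self.le.trans (Nat.pow_le_pow_left (by lia) n)⟩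

theorem PolyBdd.size : PolyBdd (Ctx.size : X → ℕ) := ⟨1, fun x => by lia⟩

theorem PolyBdd.mul {f g : X → ℕ} (hf : PolyBdd f) (hg : PolyBdd g) :
    PolyBdd fun x => f x * g x :=
  let ⟨c, hc⟩ := hf
  let ⟨d, hd⟩ := hg
  ⟨c + d, fun x => by rw [pow_add]; exact Nat.mul_le_mul (hc x) (hd x)⟩

theorem PolyBdd.add {f g : X → ℕ} (hf : PolyBdd f) (hg : PolyBdd g) :
    PolyBdd fun x => f x + g x := by
  obtain ⟨c, hc⟩ := hf
  obtain ⟨d, hd⟩ := hg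
  refine ⟨max c d + 1, fun x => ?_⟩
  have h1 : (Ctx.size x + 2) ^ c ≤ (Ctx.size x + 2) ^ max c d :=
    Nat.pow_le_pow_right (by lia) (le_max_left _ _)
  have h2 : (Ctx.size x + 2) ^ d ≤ (Ctx.size x + 2) ^ max c d :=
    Nat.pow_le_pow_right (by lia) (le_max_right _ _)
  have h3 := hc x
  have h4 := hd x
  rw [pow_succ]
  nlinarith [Nat.zero_le (Ctx.size x * (Ctx.size x + 2) ^ max c d)]

/-- A bound polynomial in the size of a derived input, whose size is polynomially bounded. -/
theorem PolyBdd.comp {f : X → ℕ} (hf : PolyBdd f) {φ : Y → X}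
    (hφ : PolyBdd fun y => Ctx.size (φ y)) : PolyBdd fun y => f (φ y) := by
  obtain ⟨c, hc⟩ := hf
  obtain ⟨d, hd⟩ := hφ.add (.const 2)
  refine ⟨d * c, fun y => (hc _).trans ?_⟩
  rw [pow_mul]
  exact Nat.pow_le_pow_left (hd y) c

/-- The largest value of `f` at the second components up to `g x` is polynomially bounded. -/
theorem PolyBdd.exists_bound {f : X × ℕ → ℕ} (hf : PolyBdd f) {g : X → ℕ} (hg : PolyBdd g) :
    ∃ B : X → ℕ, PolyBdd B ∧ ∀ x, ∀ i ≤ g x, f (x, i) ≤ B x := by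
  obtain ⟨c, hc⟩ := hf
  have h : PolyBdd fun p : X × ℕ => (Ctx.size p + 2) ^ c := ⟨c, fun _ => le_rfl⟩
  refine ⟨fun x => (Ctx.size (x, g x) + 2) ^ c, h.comp (φ := fun x => (x, g x)) ?_, ?_⟩
  · simp only [Ctx.size_prod]
    exact PolyBdd.size.add hg
  · intro x i hi
    refine (hc _).trans (Nat.pow_le_pow_left ?_ c)
    rw [Ctx.size_prod, Ctx.size_prod]
    lia

/-! ### Functions computable in polynomial time -/

/-- `f` is computable in polynomial time, with unary numbers and with polynomially bounded values.
Whatever counters `loc i` hold the numbers of the input, if `K` and all later counters are free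
(and zero), then there is a program that writes the value into `K` and leaves everything else
unchanged. -/
def PT (f : X → ℕ) : Prop :=
  ∃ T : X → ℕ, PolyBdd T ∧ (∀ x, f x ≤ T x) ∧ ∀ (loc : ℕ → ℕ) (K : ℕ), (∀ i < dim X, loc i < K) →
    ∃ p : Cmd, ∀ (x : X) (s : ℕ → ℕ), (∀ i < dim X, s (loc i) = coord x i) →
      (∀ r, K ≤ r → s r = 0) → ExecLE p ⟨inp x, [], s⟩ ⟨inp x, [], update s K (f x)⟩ (T x)

theorem PT.polyBdd {f : X → ℕ} (hf : PT f) : PolyBdd f :=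
  let ⟨_, hT, h, _⟩ := hf
  hT.mono h

/-- A renaming of variables: the inputs `y` and `φ y` have the same word, and every number of `φ y`
is a fixed one of the numbers of `y`. -/
def Renaming (φ : Y → X) : Prop :=
  (∀ y, inp (φ y) = inp y) ∧
    ∃ ρ : ℕ → ℕ, ∀ i < dim X, ρ i < dim Y ∧ ∀ y, coord (φ y) i = coord y (ρ i)

theorem Renaming.fst : Renaming (Prod.fst : X × ℕ → X) :=
  ⟨fun _ => rfl, id, fun _ hi => ⟨Nat.lt_succ_of_lt hi, fun _ => (if_neg hi.ne).symm⟩⟩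

theorem Renaming.prod {φ : Y → X} (hφ : Renaming φ) :
    Renaming fun p : Y × ℕ => (φ p.1, p.2) := by
  obtain ⟨h, ρ, hρ⟩ := hφ
  refine ⟨fun p => h p.1, fun i => if i = dim X then dim Y else ρ i, fun i hi => ?_⟩
  change i < dim X + 1 at hi
  change (if i = dim X then dim Y else ρ i) < dim Y + 1 ∧ ∀ y : Y × ℕ,
    (if i = dim X then y.2 else coord (φ y.1) i) =
    if (if i = dim X then dim Y else ρ i) = dim Y then y.2
    else coord y.1 (if i = dim X then dim Y else ρ i)
  by_cases hi' : i = dim X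
  · simp [hi']
  · simp only [if_neg hi']
    obtain ⟨h1, h2⟩ := hρ i (by lia)
    exact ⟨by lia, fun y => by rw [if_neg h1.ne, h2]⟩

theorem PT.rename {f : X → ℕ} (hf : PT f) {φ : Y → X} (hφ : Renaming φ) :
    PT fun y => f (φ y) := by
  obtain ⟨hi, ρ, hρ⟩ := hφ
  obtain ⟨T, hT, hfT, h⟩ := hf
  have hsize : PolyBdd fun y => Ctx.size (φ y) := by
    refine ((PolyBdd.const (X := Y) (dim X + 1)).mul .size).mono fun y => ?_
    have h1 : ∑ i ∈ Finset.range (dim X), coord (φ y) i ≤ dim X * Ctx.size y := by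
      refine (Finset.sum_le_card_nsmul _ _ (Ctx.size y) fun i hi => ?_).trans (by simp)
      rw [Finset.mem_range] at hi
      rw [(hρ i hi).2 y]
      refine le_add_left (Finset.single_le_sum (f := fun i => coord y i) (fun _ _ => Nat.zero_le _)
        (Finset.mem_range.2 (hρ i hi).1))
    have h2 : (inp y).length ≤ Ctx.size y := Nat.le_add_right _ _
    rw [Ctx.size, hi, add_mul, one_mul]
    lia
  refine ⟨fun y => T (φ y), hT.comp hsize, fun y => hfT _, fun loc K hloc => ?_⟩
  obtain ⟨p, hp⟩ := h (fun i => loc (ρ i)) K fun i hi => hloc _ (hρ i hi).1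
  refine ⟨p, fun y s hs h0 => ?_⟩
  have := hp (φ y) s (fun i hi => by rw [hs _ (hρ i hi).1, (hρ i hi).2]) h0
  rwa [hi] at this

/-- Weakening: `f` does not depend on the last variable. -/
theorem PT.wk {f : X → ℕ} (hf : PT f) : PT fun p : X × ℕ => f p.1 := hf.rename .fst

/-- Weakening: `f` does not depend on the last but one variable. -/
theorem PT.wkMid {f : X × ℕ → ℕ} (hf : PT f) : PT fun p : (X × ℕ) × ℕ => f (p.1.1, p.2) :=
  hf.rename (.prod .fst)

theorem PT.zero : PT fun _ : X => 0 := by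
  refine ⟨fun _ => 1, .const 1, fun _ => Nat.zero_le _,
    fun loc K _ => ⟨.clear K, fun x s _ h0 => ?_⟩⟩
  have h := Cmd.execLE_clear K (inp x) [] s
  rwa [h0 K le_rfl] at h

theorem PT.succ {f : X → ℕ} (hf : PT f) : PT fun x => f x + 1 := by
  obtain ⟨T, hT, hfT, h⟩ := hf
  refine ⟨fun x => T x + 1, hT.add (.const 1), fun x => Nat.succ_le_succ (hfT x),
    fun loc K hloc => ?_⟩
  obtain ⟨p, hp⟩ := h loc K hloc
  refine ⟨.seq p (.instr (.inc K)), fun x s hs h0 => ?_⟩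
  have := (hp x s hs h0).seq (ExecLE.instr (.inc K) _)
  simpa [Instr.run] using this

theorem PT.const (n : ℕ) : PT fun _ : X => n := by
  induction n with
  | zero => exact .zero
  | succ n ih => exact ih.succ

theorem PT.var : PT fun p : X × ℕ => p.2 := by
  refine ⟨fun p => 7 * Ctx.size p + 2, ((PolyBdd.const 7).mul .size).add (.const 2), fun p => ?_,
    fun loc K hloc => ⟨.seq (.loop (.pos (loc (dim X)))
      (.seq (.instr (.dec (loc (dim X)))) (.seq (.instr (.inc K)) (.instr (.inc (K + 1))))))
      (.move (K + 1) (loc (dim X))), fun p s hs h0 => ?_⟩⟩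
  · have h : Ctx.size p = Ctx.size p.1 + p.2 := Ctx.size_prod p.1 p.2
    lia
  set a := loc (dim X) with ha
  have haK : a < K := hloc (dim X) (Nat.lt_succ_self _)
  have hsa : s a = p.2 := (hs (dim X) (Nat.lt_succ_self _)).trans (if_pos rfl)
  have hsize : p.2 ≤ Ctx.size p := by
    rw [show p = (p.1, p.2) from rfl, Ctx.size_prod]
    exact Nat.le_add_left _ _
  have h1 := ExecLE.loop (b := .pos a)
    (c := .seq (.instr (.dec a)) (.seq (.instr (.inc K)) (.instr (.inc (K + 1)))))
    (fun j => ⟨inp p, [], update (update (update s a j) K (p.2 - j)) (K + 1) (p.2 - j)⟩) 3 p.2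
    (fun j _ => by simp [Test.holds, Function.update_of_ne (show a ≠ K + 1 by lia),
      Function.update_of_ne haK.ne]) fun j hj => by
      have h := (ExecLE.instr (.dec a) ⟨inp p, [], update (update (update s a (j + 1)) K
        (p.2 - (j + 1))) (K + 1) (p.2 - (j + 1))⟩).seq
        ((ExecLE.instr (.inc K) _).seq (ExecLE.instr (.inc (K + 1)) _))
      refine h.to ?_
      simp only [Instr.run]
      congr 1
      funext i
      simp only [Function.update_apply]
      split_ifs <;> lia
  have h2 := Cmd.execLE_move (r := K + 1) (r' := a) (by lia) (inp p) []
    (update (update (update s a 0) K p.2) (K + 1) p.2)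
  have hstart : update (update (update s a p.2) K (p.2 - p.2)) (K + 1) (p.2 - p.2) = s := by
    funext i
    simp only [Function.update_apply]
    have hK := h0 K le_rfl
    have hK1 := h0 (K + 1) (by lia)
    split_ifs <;> simp_all
  simp only [hstart, Nat.sub_zero] at h1
  have hend : update (update (update (update (update s a 0) K p.2) (K + 1) p.2) (K + 1) 0) a
      (update (update (update s a 0) K p.2) (K + 1) p.2 a +
        update (update (update s a 0) K p.2) (K + 1) p.2 (K + 1)) = update s K p.2 := by
    funext i
    simp only [Function.update_apply]
    have hK1 := h0 (K + 1) (by lia)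
    split_ifs <;> simp_all
  rw [hend] at h2
  refine (h1.seq h2).mono ?_
  simp only [Function.update_self]
  lia

/-- The length of the input word. -/
theorem PT.length : PT fun x : X => (inp x).length := by
  refine ⟨fun x => 7 * Ctx.size x + 2, ((PolyBdd.const 7).mul .size).add (.const 2), fun x => ?_,
    fun loc K hloc => ⟨.seq (.loop .more
      (.seq (.instr .moveRight) (.seq (.instr (.inc K)) (.instr (.inc (K + 1))))))
      (.rewind (K + 1)), fun x s hs h0 => ?_⟩⟩
  · have h : (inp x).length ≤ Ctx.size x := Nat.le_add_right _ _
    lia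
  set w := inp x
  have hsize : w.length ≤ Ctx.size x := Nat.le_add_right _ _
  have h1 := ExecLE.loop (b := .more)
    (c := .seq (.instr .moveRight) (.seq (.instr (.inc K)) (.instr (.inc (K + 1)))))
    (fun j => Store.at w (min (w.length - j) w.length)
      (update (update s K (w.length - j)) (K + 1) (w.length - j))) 3 w.length
    (fun j hj => by
      simp only [Test.holds, Store.at, ne_eq, List.drop_eq_nil_iff, not_le]
      lia) fun j hj => by
      have h := (ExecLE.instr .moveRight (Store.at w (min (w.length - (j + 1)) w.length)
        (update (update s K (w.length - (j + 1))) (K + 1) (w.length - (j + 1))))).seq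
        ((ExecLE.instr (.inc K) _).seq (ExecLE.instr (.inc (K + 1)) _))
      rw [Store.moveRight_at, show w.length - (j + 1) + 1 = w.length - j by lia] at h
      refine h.to ?_
      simp only [Instr.run, Store.at]
      congr 1
      funext i
      simp only [Function.update_apply]
      split_ifs <;> lia
  have h2 := Cmd.execLE_rewind (K + 1) w
    (update (update s K w.length) (K + 1) w.length) le_rfl (by simp)
  have hstart : update (update s K 0) (K + 1) 0 = s := by
    funext i
    simp only [Function.update_apply]
    have hK := h0 K le_rfl
    have hK1 := h0 (K + 1) (by lia)
    split_ifs <;> simp_all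
  simp only [Nat.sub_self, Nat.sub_zero, min_self, Nat.zero_min, hstart, Store.at_zero] at h1
  have hend : update (update (update s K w.length) (K + 1) w.length) (K + 1) 0 =
      update s K w.length := by
    funext i
    simp only [Function.update_apply]
    have hK1 := h0 (K + 1) (by lia)
    split_ifs <;> simp_all
  rw [hend] at h2
  refine (h1.seq h2).mono ?_
  simp only [Function.update_self]
  lia

/-- Random access to the input word. -/
theorem PT.symbol {f : X → ℕ} (hf : PT f) (a : Γ') :
    PT fun x => if (inp x)[f x]? = some a then 1 else 0 := by
  obtain ⟨T, hT, hfT, h⟩ := hf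
  refine ⟨fun x => 8 * T x + 5, ((PolyBdd.const 8).mul hT).add (.const 5), fun x => ?_,
    fun loc K hloc => ?_⟩
  · beta_reduce
    split_ifs <;> lia
  obtain ⟨p, hp⟩ := h loc K hloc
  refine ⟨.seq p (.seq (.loop (.pos K)
    (.seq (.instr (.dec K)) (.seq (.instr (.inc (K + 1))) (.instr .moveRight))))
    (.seq (.instr (.probe a K)) (.rewind (K + 1)))), fun x s hs h0 => ?_⟩
  have h1 := hp x s hs h0
  have hn := hfT x
  set w := inp x
  set n := f x
  have h2 := ExecLE.loop (b := .pos K)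
    (c := .seq (.instr (.dec K)) (.seq (.instr (.inc (K + 1))) (.instr .moveRight)))
    (fun j => Store.at w (min (n - j) w.length) (update (update s K j) (K + 1) (n - j))) 3 n
    (fun j hj => by simp [Test.holds, Store.at]) fun j hj => by
      have h := (ExecLE.instr (.dec K) (Store.at w (min (n - (j + 1)) w.length)
        (update (update s K (j + 1)) (K + 1) (n - (j + 1))))).seq
        ((ExecLE.instr (.inc (K + 1)) _).seq (ExecLE.instr .moveRight _))
      have e : (Instr.inc (K + 1)).run ((Instr.dec K).run (Store.at w (min (n - (j + 1)) w.length)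
          (update (update s K (j + 1)) (K + 1) (n - (j + 1))))) =
          Store.at w (min (n - (j + 1)) w.length) (update (update s K j) (K + 1) (n - j)) := by
        simp only [Instr.run, Store.at]
        congr 1
        funext i
        simp only [Function.update_apply]
        split_ifs <;> lia
      rwa [e, Store.moveRight_at, show n - (j + 1) + 1 = n - j by lia] at h
  have h3 := ExecLE.instr (.probe a K) (Store.at w (min n w.length)
    (update (update s K 0) (K + 1) n))
  have e3 : (Instr.probe a K).run (Store.at w (min n w.length)
      (update (update s K 0) (K + 1) n)) = Store.at w (min n w.length)
      (update (update s K (if w[n]? = some a then 1 else 0)) (K + 1) n) := by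
    have hhead : (w.drop (min n w.length)).head? = w[n]? := by
      rw [List.head?_drop]
      rcases le_total n w.length with h | h
      · rw [min_eq_left h]
      · rw [min_eq_right h, List.getElem?_eq_none le_rfl, List.getElem?_eq_none h]
    simp only [Instr.run, Store.at, hhead]
    split_ifs
    · congr 1
      funext i
      simp only [Function.update_apply]
      split_ifs <;> lia
    · rfl
  rw [e3] at h3
  have h4 := Cmd.execLE_rewind (K + 1) w
    (update (update s K (if w[n]? = some a then 1 else 0)) (K + 1) n)
    (min_le_right n w.length) (by simp)
  have hstart : update (update s K n) (K + 1) 0 = update s K n := by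
    funext i
    simp only [Function.update_apply]
    have hK1 := h0 (K + 1) (by lia)
    split_ifs <;> simp_all
  simp only [Nat.sub_self, Nat.sub_zero, Nat.zero_min, hstart, Store.at_zero] at h2
  have hend : ∀ b, update (update (update s K b) (K + 1) n) (K + 1) 0 = update s K b := by
    intro b
    funext i
    simp only [Function.update_apply]
    have hK1 := h0 (K + 1) (by lia)
    split_ifs <;> simp_all
  rw [hend] at h4
  refine (h1.seq (h2.seq (h3.seq h4))).mono ?_
  simp only [Function.update_self]
  lia

/-- Primitive recursion with polynomially bounded values. -/
theorem PT.recursion {n a : X → ℕ} {h : X → ℕ → ℕ → ℕ} (hn : PT n) (ha : PT a)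
    (hh : PT fun p : (X × ℕ) × ℕ => h p.1.1 p.1.2 p.2) {R : X → ℕ} (hR : PolyBdd R)
    (hb : ∀ x, ∀ i ≤ n x, Nat.rec (motive := fun _ => ℕ) (a x) (h x) i ≤ R x) :
    PT fun x => Nat.rec (motive := fun _ => ℕ) (a x) (fun i r => h x i r) (n x) := by
  obtain ⟨Tn, hTn, hnT, hn⟩ := hn
  obtain ⟨Ta, hTa, haT, ha⟩ := ha
  obtain ⟨Th, hTh, hhT, hh⟩ := hh
  obtain ⟨B', hB', hhB'⟩ := hTh.exists_bound (g := fun p : X × ℕ => R p.1)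
    (hR.comp (φ := Prod.fst) (PolyBdd.size.mono fun p => by
      rw [show p = (p.1, p.2) from rfl, Ctx.size_prod]
      exact Nat.le_add_right _ _))
  obtain ⟨B, hB, hhB⟩ := hB'.exists_bound (hTn.mono hnT)
  refine ⟨fun x => Tn x + (Ta x + ((Tn x * (B x + 5 * R x + 5) + 1) +
      (2 * Tn x + 1 + (3 * R x + 1)))),
    ?_, fun x => ?_, fun loc K hloc => ?_⟩
  · have h1 := (hB.add ((PolyBdd.const 5).mul hR)).add (.const 5)
    exact hTn.add (hTa.add (((hTn.mul h1).add (.const 1)).add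
      ((((PolyBdd.const 2).mul hTn).add (.const 1)).add
        (((PolyBdd.const 3).mul hR).add (.const 1)))))
  · have := hb x (n x) le_rfl
    lia
  obtain ⟨pn, hpn⟩ := hn loc K hloc
  obtain ⟨pa, hpa⟩ := ha loc (K + 2) fun i hi => (hloc i hi).trans (by lia)
  let loc' : ℕ → ℕ := update (update loc (dim X) (K + 1)) (dim X + 1) (K + 2)
  obtain ⟨ph, hph⟩ := hh loc' (K + 3) fun i hi => by
    change i < dim X + 1 + 1 at hi
    simp only [loc', Function.update_apply]
    split_ifs with h1 h2
    · lia
    · lia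
    · exact (hloc i (by lia)).trans (by lia)
  -- Counter `K` holds the number of rounds to go, `K + 1` the index, and `K + 2` the value.
  refine ⟨.seq pn (.seq pa (.seq (.loop (.pos K) (.seq (.instr (.dec K)) (.seq ph
    (.seq (.clear (K + 2)) (.seq (.move (K + 3) (K + 2)) (.instr (.inc (K + 1))))))))
    (.seq (.clear (K + 1)) (.move (K + 2) K)))), fun x s hs h0 => ?_⟩
  let v : ℕ → ℕ := fun i => Nat.rec (motive := fun _ => ℕ) (a x) (fun i r => h x i r) i
  have hv : ∀ i ≤ n x, v i ≤ R x := hb x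
  have hne : ∀ {i c}, i < dim X → loc i ≠ K + c := fun hi e => by have := hloc _ hi; lia
  have hne0 : ∀ {i}, i < dim X → loc i ≠ K := fun hi => hne (c := 0) hi
  have e1 := hpn x s hs h0
  have e2 := hpa x (update s K (n x)) (fun i hi => by
      rw [Function.update_of_ne (hne0 hi)]; exact hs i hi) fun r hr => by
      rw [Function.update_of_ne (by lia)]; exact h0 r (by lia)
  have e3 := ExecLE.loop (b := .pos K) (c := .seq (.instr (.dec K)) (.seq ph
    (.seq (.clear (K + 2)) (.seq (.move (K + 3) (K + 2)) (.instr (.inc (K + 1)))))))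
    (fun j => ⟨inp x, [], update (update (update s K j) (K + 1) (n x - j)) (K + 2) (v (n x - j))⟩)
    (B x + 5 * R x + 4) (n x) (fun j hj => by
      simp [Test.holds]) fun j hj => by
      set i := n x - (j + 1) with hi
      have hij : n x - j = i + 1 := by lia
      have hvi : v (i + 1) = h x i (v i) := rfl
      have g1 := ExecLE.instr (.dec K)
        ⟨inp x, [], update (update (update s K (j + 1)) (K + 1) i) (K + 2) (v i)⟩
      have g1' : (Instr.dec K).run
          ⟨inp x, [], update (update (update s K (j + 1)) (K + 1) i) (K + 2) (v i)⟩ =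
          ⟨inp x, [], update (update (update s K j) (K + 1) i) (K + 2) (v i)⟩ := by
        simp only [Instr.run]
        congr 1
        funext r
        simp only [Function.update_apply]
        split_ifs <;> lia
      rw [g1'] at g1
      set s₁ := update (update (update s K j) (K + 1) i) (K + 2) (v i) with hs₁
      have g2 := hph ((x, i), v i) s₁ (fun r hr => by
          change r < dim X + 1 + 1 at hr
          change s₁ (loc' r) = if r = dim X + 1 then v i else if r = dim X then i else coord x r
          simp only [loc', Function.update_apply]
          split_ifs with h1 h2
          · simp [hs₁]
          · simp [hs₁]
          · have hr' : r < dim X := by lia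
            rw [hs₁, Function.update_of_ne (hne hr'), Function.update_of_ne (hne hr'),
              Function.update_of_ne (hne0 hr'), hs r hr']) fun r hr => by
          rw [hs₁, Function.update_of_ne (by lia), Function.update_of_ne (by lia),
            Function.update_of_ne (by lia), h0 r (by lia)]
      have g3 := Cmd.execLE_clear (K + 2) (inp x) [] (update s₁ (K + 3) (h x i (v i)))
      have g4 := Cmd.execLE_move (r := K + 3) (r' := K + 2) (by lia) (inp x) []
        (update (update s₁ (K + 3) (h x i (v i))) (K + 2) 0)
      have g5 := g1.seq (g2.seq (g3.seq (g4.seq (ExecLE.instr (.inc (K + 1)) _))))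
      have c1 : Th ((x, i), v i) ≤ B x := by
        refine (hhB' (x, i) (v i) (hv i (by lia))).trans (hhB x i (by lia))
      have c2 : update s₁ (K + 3) (h x i (v i)) (K + 2) = v i := by
        simp [hs₁]
      have c3 : update (update s₁ (K + 3) (h x i (v i))) (K + 2) 0 (K + 3) = v (i + 1) := by
        simp [hvi]
      have c4 := hv i (by lia)
      have c5 := hv (i + 1) (by lia)
      rw [c2, c3] at g5
      refine (g5.mono (B' := B x + 5 * R x + 4) (by lia)).to ?_
      rw [hij]
      simp only [Instr.run]
      congr 1
      funext r
      have hK3 := h0 (K + 3) (by lia)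
      simp only [hs₁, Function.update_apply]
      split_ifs <;> lia
  have e3' : update (update (update s K (n x)) (K + 1) (n x - n x)) (K + 2) (v (n x - n x)) =
      update (update s K (n x)) (K + 2) (a x) := by
    funext r
    have hK1 := h0 (K + 1) (by lia)
    simp only [Nat.sub_self, Function.update_apply]
    split_ifs <;> first | lia | rfl
  simp only [e3', Nat.sub_zero] at e3
  set s₂ := update (update (update s K 0) (K + 1) (n x)) (K + 2) (v (n x)) with hs₂
  have e4 := Cmd.execLE_clear (K + 1) (inp x) [] s₂
  have e5 := Cmd.execLE_move (r := K + 2) (r' := K) (by lia) (inp x) [] (update s₂ (K + 1) 0)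
  have c1 : s₂ (K + 1) = n x := by simp [hs₂]
  have c2 : update s₂ (K + 1) 0 (K + 2) = v (n x) := by simp [hs₂]
  rw [c1] at e4
  rw [c2] at e5
  have c3 := hnT x
  have c4 := hv (n x) le_rfl
  have c5 : n x * (B x + 5 * R x + 4 + 1) ≤ Tn x * (B x + 5 * R x + 5) := Nat.mul_le_mul_right _ c3
  refine ((e1.seq (e2.seq (e3.seq (e4.seq e5)))).mono (by lia)).to ?_
  congr 1
  funext r
  have hK1 := h0 (K + 1) (by lia)
  have hK2 := h0 (K + 2) (by lia)
  simp only [hs₂, Function.update_apply]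
  split_ifs <;> lia

end PolyTime

section Closure

variable {X Y : Type} [Ctx X] [Ctx Y]

/-! ### Arithmetic and bounded quantifiers -/

theorem PT.congr {f g : X → ℕ} (hf : PT f) (h : ∀ x, f x = g x) : PT g := funext h ▸ hf

/-- Substitution for the last variable. -/
theorem PT.subst {g : X × ℕ → ℕ} (hg : PT g) {f : X → ℕ} (hf : PT f) : PT fun x => g (x, f x) := by
  obtain ⟨B, hB, hgB⟩ := hg.polyBdd.exists_bound hf.polyBdd
  refine PT.recursion (n := fun _ => 1) (a := f) (h := fun x _ r => g (x, r)) (.const 1) hf hg.wkMid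
    (hf.polyBdd.add hB) fun x i hi => ?_
  rcases Nat.le_one_iff_eq_zero_or_eq_one.1 hi with rfl | rfl
  · exact Nat.le_add_right _ _
  · exact (hgB x _ le_rfl).trans (Nat.le_add_left _ _)

theorem PT.add {f g : X → ℕ} (hf : PT f) (hg : PT g) : PT fun x => f x + g x := by
  have key : ∀ x i, Nat.rec (motive := fun _ => ℕ) (f x) (fun _ r => r + 1) i = f x + i := by
    intro x i
    induction i with
    | zero => rfl
    | succ i ih => exact congrArg (· + 1) ih
  exact (PT.recursion hg hf (h := fun _ _ r => r + 1) PT.var.succ (hf.polyBdd.add hg.polyBdd)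
    fun x i hi => by rw [key]; lia).congr fun x => key x _

theorem PT.mul {f g : X → ℕ} (hf : PT f) (hg : PT g) : PT fun x => f x * g x := by
  have key : ∀ x i, Nat.rec (motive := fun _ => ℕ) 0 (fun _ r => r + g x) i = i * g x := by
    intro x i
    induction i with
    | zero => exact (Nat.zero_mul _).symm
    | succ i ih => exact (congrArg (· + g x) ih).trans (Nat.succ_mul i (g x)).symm
  exact (PT.recursion hf PT.zero (h := fun x _ r => r + g x) (PT.var.add hg.wk.wk)
    (hf.polyBdd.mul hg.polyBdd) fun x i hi => by rw [key]; exact Nat.mul_le_mul_right _ hi).congr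
      fun x => key x _

theorem PT.pred {f : X → ℕ} (hf : PT f) : PT fun x => f x - 1 := by
  have key : ∀ i, Nat.rec (motive := fun _ => ℕ) 0 (fun i _ => i) i = i - 1 := by
    intro i
    cases i <;> rfl
  exact (PT.recursion hf PT.zero (h := fun _ i _ => i) PT.var.wk hf.polyBdd
    fun x i hi => by rw [key]; lia).congr fun x => key _

theorem PT.sub {f g : X → ℕ} (hf : PT f) (hg : PT g) : PT fun x => f x - g x := by
  have key : ∀ x i, Nat.rec (motive := fun _ => ℕ) (f x) (fun _ r => r - 1) i = f x - i := by
    intro x i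
    induction i with
    | zero => rfl
    | succ i ih => exact congrArg (· - 1) ih
  exact (PT.recursion hg hf (h := fun _ _ r => r - 1) PT.var.pred hf.polyBdd
    fun x i hi => by rw [key]; lia).congr fun x => key x _

theorem PT.sum {n : X → ℕ} {g : X → ℕ → ℕ} (hn : PT n) (hg : PT fun p : X × ℕ => g p.1 p.2) :
    PT fun x => ∑ i ∈ Finset.range (n x), g x i := by
  have key : ∀ x i, Nat.rec (motive := fun _ => ℕ) 0 (fun i r => r + g x i) i =
      ∑ j ∈ Finset.range i, g x j := by
    intro x i
    induction i with
    | zero => rfl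
    | succ i ih => exact (congrArg (· + g x i) ih).trans (Finset.sum_range_succ _ _).symm
  obtain ⟨B, hB, hgB⟩ := hg.polyBdd.exists_bound hn.polyBdd
  refine (PT.recursion hn PT.zero (h := fun x i r => r + g x i) (PT.var.add hg.wk)
    (hn.polyBdd.mul hB) fun x i hi => ?_).congr fun x => key x _
  rw [key]
  refine (Finset.sum_le_card_nsmul _ _ (B x) fun j hj => hgB x j ?_).trans ?_
  · have := Finset.mem_range.1 hj
    lia
  · rw [Finset.card_range, smul_eq_mul]
    exact Nat.mul_le_mul_right _ hi

open Classical in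
/-- The predicate `p` is decidable in polynomial time, with unary numbers. -/
def PTPred (p : X → Prop) : Prop := PT fun x => if p x then 1 else 0

theorem PTPred.congr {p q : X → Prop} (hp : PTPred p) (h : ∀ x, p x ↔ q x) : PTPred q :=
  (funext fun x => propext (h x) : p = q) ▸ hp

theorem PTPred.toPT {p : X → Prop} [DecidablePred p] (hp : PTPred p) :
    PT fun x => if p x then 1 else 0 :=
  PT.congr hp fun x => by congr

theorem PTPred.wk {p : X → Prop} (hp : PTPred p) : PTPred fun q : X × ℕ => p q.1 := PT.wk hp

theorem PTPred.subst {p : X × ℕ → Prop} (hp : PTPred p) {f : X → ℕ} (hf : PT f) :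
    PTPred fun x => p (x, f x) := PT.subst hp hf

theorem PTPred.le {f g : X → ℕ} (hf : PT f) (hg : PT g) : PTPred fun x => f x ≤ g x :=
  ((PT.const 1).sub (hf.sub hg)).congr fun x => by split_ifs <;> lia

theorem PTPred.not {p : X → Prop} (hp : PTPred p) : PTPred fun x => ¬ p x :=
  ((PT.const 1).sub hp).congr fun x => by by_cases h : p x <;> simp [h]

theorem PTPred.and {p q : X → Prop} (hp : PTPred p) (hq : PTPred q) : PTPred fun x => p x ∧ q x :=
  (PT.mul hp hq).congr fun x => by by_cases h : p x <;> by_cases h' : q x <;> simp [h, h']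

theorem PTPred.or {p q : X → Prop} (hp : PTPred p) (hq : PTPred q) : PTPred fun x => p x ∨ q x :=
  (hp.not.and hq.not).not.congr fun x => by tauto

theorem PTPred.imp {p q : X → Prop} (hp : PTPred p) (hq : PTPred q) : PTPred fun x => p x → q x :=
  (hp.and hq.not).not.congr fun x => by tauto

theorem PTPred.iff {p q : X → Prop} (hp : PTPred p) (hq : PTPred q) : PTPred fun x => p x ↔ q x :=
  ((hp.imp hq).and (hq.imp hp)).congr fun x => by tauto

theorem PTPred.lt {f g : X → ℕ} (hf : PT f) (hg : PT g) : PTPred fun x => f x < g x :=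
  (PTPred.le hg hf).not.congr fun _ => not_le

theorem PTPred.eq {f g : X → ℕ} (hf : PT f) (hg : PT g) : PTPred fun x => f x = g x :=
  ((PTPred.le hf hg).and (PTPred.le hg hf)).congr fun x => by lia

open Classical in
theorem PTPred.exists_lt {n : X → ℕ} {p : X → ℕ → Prop} (hn : PT n)
    (hp : PTPred fun q : X × ℕ => p q.1 q.2) : PTPred fun x => ∃ i < n x, p x i :=
  (PTPred.lt PT.zero (PT.sum (g := fun x i => if p x i then 1 else 0) hn hp)).congr fun x => by
    rw [Finset.sum_pos_iff]
    refine ⟨fun ⟨i, hi, h⟩ => ⟨i, Finset.mem_range.1 hi, ?_⟩,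
      fun ⟨i, hi, h⟩ => ⟨i, Finset.mem_range.2 hi, by simp [h]⟩⟩
    by_contra h'
    simp [h'] at h

theorem PTPred.forall_lt {n : X → ℕ} {p : X → ℕ → Prop} (hn : PT n)
    (hp : PTPred fun q : X × ℕ => p q.1 q.2) : PTPred fun x => ∀ i < n x, p x i :=
  (PTPred.exists_lt (p := fun x i => ¬ p x i) hn hp.not).not.congr fun x => by push Not; rfl

theorem PTPred.symbol {f : X → ℕ} (hf : PT f) (a : Γ') : PTPred fun x => (inp x)[f x]? = some a :=
  (PT.symbol hf a).congr fun x => by congr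

theorem PTPred.forall_symbol {p : Γ' → X → Prop} (hp : ∀ a, PTPred (p a)) :
    PTPred fun x => ∀ a, p a x := by
  refine PTPred.congr (p := fun x => ∀ a ∈ (Finset.univ : Finset Γ').toList, p a x) ?_
    fun x => by simp
  induction (Finset.univ : Finset Γ').toList with
  | nil => exact (PTPred.le (PT.zero (X := X)) PT.zero).congr fun x => by simp
  | cons a l ih => exact ((hp a).and ih).congr fun x => by simp

theorem PT.ite {p : X → Prop} [DecidablePred p] {f g : X → ℕ} (hp : PTPred p) (hf : PT f)
    (hg : PT g) : PT fun x => if p x then f x else g x :=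
  ((hp.toPT.mul hf).add (hp.not.toPT.mul hg)).congr fun x => by by_cases h : p x <;> simp [h]

theorem PT.natMin {f g : X → ℕ} (hf : PT f) (hg : PT g) : PT fun x => min (f x) (g x) :=
  (PT.ite (PTPred.le hf hg) hf hg).congr fun x => by split_ifs <;> lia

/-! ### Words computed by random access -/

/-- The word `l x` can be computed in polynomial time, symbol by symbol. -/
def PTWord (l : X → List Γ') : Prop :=
  (PT fun x => (l x).length) ∧ ∀ a, PTPred fun p : X × ℕ => (l p.1)[p.2]? = some a

theorem PTWord.get {l : X → List Γ'} (hl : PTWord l) {f : X → ℕ} (hf : PT f) (a : Γ') :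
    PTPred fun x => (l x)[f x]? = some a :=
  (hl.2 a).subst hf

theorem PTWord.rename {l : X → List Γ'} (hl : PTWord l) {φ : Y → X} (hφ : Renaming φ) :
    PTWord fun y => l (φ y) :=
  ⟨hl.1.rename hφ, fun a => PT.rename (hl.2 a) hφ.prod⟩

theorem PTWord.wk {l : X → List Γ'} (hl : PTWord l) : PTWord fun p : X × ℕ => l p.1 :=
  hl.rename .fst

theorem PTWord.inp : PTWord (inp : X → List Γ') :=
  ⟨PT.length, fun a => PTPred.symbol (X := X × ℕ) PT.var a⟩

theorem PTWord.nil : PTWord fun _ : X => [] :=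
  ⟨PT.zero, fun _ => (PTPred.lt (PT.zero (X := X × ℕ)) PT.zero).congr fun x => by simp⟩

theorem PTWord.singleton (b : Γ') : PTWord fun _ : X => [b] := by
  refine ⟨PT.const 1, fun a => ?_⟩
  by_cases h : b = a
  · exact (PTPred.eq (PT.var (X := X)) PT.zero).congr fun x => by
      rcases x.2 with _ | n <;> simp [h]
  · exact (PTPred.lt (PT.zero (X := X × ℕ)) PT.zero).congr fun x => by
      rcases x.2 with _ | n <;> simp [h]

theorem PTWord.append {l l' : X → List Γ'} (hl : PTWord l) (hl' : PTWord l') :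
    PTWord fun x => l x ++ l' x := by
  refine ⟨(hl.1.add hl'.1).congr fun x => by simp, fun a => ?_⟩
  refine (((PTPred.lt PT.var hl.1.wk).and (hl.2 a)).or
    ((PTPred.le hl.1.wk PT.var).and (hl'.wk.get (PT.var.sub hl.1.wk) a))).congr fun x => ?_
  rw [List.getElem?_append]
  split_ifs with h
  · simp [h]
  · simp [h, not_lt.1 h]

theorem PTWord.ite {p : X → Prop} [DecidablePred p] {l l' : X → List Γ'} (hp : PTPred p)
    (hl : PTWord l) (hl' : PTWord l') : PTWord fun x => if p x then l x else l' x := by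
  refine ⟨(PT.ite hp hl.1 hl'.1).congr fun x => by beta_reduce; split_ifs <;> rfl, fun a => ?_⟩
  refine ((hp.wk.and (hl.2 a)).or (hp.wk.not.and (hl'.2 a))).congr fun x => ?_
  beta_reduce
  split_ifs with h <;> simp [h]

theorem List.length_flatMap_range {α : Type*} (g : ℕ → List α) (n : ℕ) :
    ((List.range n).flatMap g).length = ∑ j ∈ Finset.range n, (g j).length := by
  induction n with
  | zero => rfl
  | succ n ih => simp [List.range_succ, Finset.sum_range_succ, ← ih]

theorem List.getElem?_flatMap_range_eq_some {α : Type*} (g : ℕ → List α) (n k : ℕ) (a : α) :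
    ((List.range n).flatMap g)[k]? = some a ↔
      ∃ i < n, ∑ j ∈ Finset.range i, (g j).length ≤ k ∧
        (g i)[k - ∑ j ∈ Finset.range i, (g j).length]? = some a := by
  induction n with
  | zero => simp
  | succ n ih =>
    rw [List.range_succ, List.flatMap_append, List.getElem?_append,
      List.length_flatMap_range]
    split_ifs with h
    · refine ih.trans ?_
      refine ⟨fun ⟨i, hi, h⟩ => ⟨i, by lia, h⟩, fun ⟨i, hi, h1, h2⟩ => ⟨i, ?_, h1, h2⟩⟩
      rcases Nat.lt_succ_iff_lt_or_eq.1 hi with hi | rfl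
      · exact hi
      · lia
    · simp only [List.flatMap_singleton]
      refine ⟨fun h' => ⟨n, by lia, by lia, h'⟩, fun ⟨i, hi, h1, h2⟩ => ?_⟩
      rcases Nat.lt_succ_iff_lt_or_eq.1 hi with hi | rfl
      · have h3 : k - ∑ j ∈ Finset.range i, (g j).length < (g i).length :=
          (List.getElem?_eq_some_iff.1 h2).1
        have h4 : ∑ j ∈ Finset.range (i + 1), (g j).length ≤ ∑ j ∈ Finset.range n, (g j).length :=
          Finset.sum_le_sum_of_subset (Finset.range_mono (by lia))
        rw [Finset.sum_range_succ] at h4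
        lia
      · exact h2

/-- Concatenation of a family of words: the symbol at position `k` lies in the word `i` for which
`k` is not smaller than the total length of the words before `i`, but by less than the length of
word `i`. -/
theorem PTWord.flatMap {n : X → ℕ} {g : X → ℕ → List Γ'} (hn : PT n)
    (hg : PTWord fun p : X × ℕ => g p.1 p.2) :
    PTWord fun x => (List.range (n x)).flatMap (g x) := by
  refine ⟨(PT.sum (g := fun x i => (g x i).length) hn hg.1).congr fun x =>
    (List.length_flatMap_range _ _).symm, fun a => ?_⟩
  have hS : PT fun q : (X × ℕ) × ℕ => ∑ j ∈ Finset.range q.2, (g q.1.1 j).length :=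
    PT.sum (X := (X × ℕ) × ℕ) (g := fun q j => (g q.1.1 j).length) PT.var hg.1.wkMid.wkMid
  refine (PTPred.exists_lt (X := X × ℕ) (n := fun q => n q.1)
    (p := fun q i => ∑ j ∈ Finset.range i, (g q.1 j).length ≤ q.2 ∧
      (g q.1 i)[q.2 - ∑ j ∈ Finset.range i, (g q.1 j).length]? = some a) hn.wk
    ((PTPred.le hS PT.var.wk).and ?_)).congr fun q =>
      (List.getElem?_flatMap_range_eq_some _ _ _ _).symm
  exact (hg.rename (.prod .fst)).get (PT.var.wk.sub hS) a

theorem PTWord.eq {l l' : X → List Γ'} (hl : PTWord l) (hl' : PTWord l') :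
    PTPred fun x => l x = l' x := by
  refine ((PTPred.eq hl.1 hl'.1).and (PTPred.forall_lt
    (p := fun x i => ∀ a, (l x)[i]? = some a ↔ (l' x)[i]? = some a) hl.1
    (PTPred.forall_symbol fun a => (hl.2 a).iff (hl'.2 a)))).congr fun x =>
      ⟨fun ⟨h1, h2⟩ => ?_, fun h => by simp [h]⟩
  refine List.ext_getElem? fun i => ?_
  rcases lt_or_ge i (l x).length with hi | hi
  · exact Option.ext fun a => by simpa using h2 i hi a
  · rw [List.getElem?_eq_none hi, List.getElem?_eq_none (h1 ▸ hi)]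

/-- The number with binary digits `l`, least significant digit first. -/
def binVal (l : List Γ') : ℕ := l.foldr (fun a r => 2 * r + if a = Γ'.bit true then 1 else 0) 0

theorem binVal_cons (a : Γ') (l : List Γ') :
    binVal (a :: l) = 2 * binVal l + if a = Γ'.bit true then 1 else 0 := by
  simp only [binVal, List.foldr_cons]

/-- Binary numbers can be read up to a polynomial cap. -/
theorem PT.min_binVal {l : X → List Γ'} (hl : PTWord l) {n : X → ℕ} (hn : PT n) :
    PT fun x => min (n x) (binVal (l x)) := by
  classical
  have key : ∀ x, ∀ i ≤ (l x).length, Nat.rec (motive := fun _ => ℕ) 0 (fun i r => min (n x)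
      (2 * r + if (l x)[(l x).length - (i + 1)]? = some (Γ'.bit true) then 1 else 0)) i =
      min (n x) (binVal ((l x).drop ((l x).length - i))) := by
    intro x i
    induction i with
    | zero => simp [binVal]
    | succ i ih =>
      intro hi
      have h : (l x).length - (i + 1) < (l x).length := by lia
      rw [List.drop_eq_getElem_cons h, show (l x).length - (i + 1) + 1 = (l x).length - i by lia]
      simp only [ih (by lia), List.getElem?_eq_getElem h, Option.some.injEq]
      rw [binVal_cons]
      lia
  have hbit : PTPred fun p : (X × ℕ) × ℕ =>
      (l p.1.1)[(l p.1.1).length - (p.1.2 + 1)]? = some (Γ'.bit true) :=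
    hl.wk.wk.get (hl.1.wk.wk.sub PT.var.wk.succ) _
  refine (PT.recursion hl.1 PT.zero (h := fun x i r => min (n x)
      (2 * r + if (l x)[(l x).length - (i + 1)]? = some (Γ'.bit true) then 1 else 0))
    (hn.wk.wk.natMin (((PT.const 2).mul PT.var).add hbit.toPT)) hn.polyBdd fun x i hi => ?_).congr
      fun x => ?_
  · exact (key x i hi).trans_le (min_le_left _ _)
  · rw [key x _ le_rfl]
    simp

/-- A language is in P if membership is a predicate decidable in polynomial time. -/
theorem PTPred.inP {L : Language Γ'} (hL : PTPred fun w : List Γ' => w ∈ L) : InP L := by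
  classical
  obtain ⟨T, hT, -, h⟩ := hL
  obtain ⟨p, hp⟩ := h id 0 fun i hi => absurd hi (Nat.not_lt_zero i)
  obtain ⟨c, hc⟩ := (hT.add ((PolyBdd.const 2).mul .size)).add (.const 1)
  refine InP.of_exec (fun w => decide (w ∈ L)) (fun w => decide_eq_true_iff)
    (.seq p (.loop .more (.instr .drop))) c fun w => ?_
  have h1 := hp w (fun _ => 0) (fun i hi => absurd hi (Nat.not_lt_zero i)) fun _ _ => rfl
  set s := Function.update (fun _ => 0) 0 (if w ∈ L then 1 else 0)
  have h2 := ExecLE.loop (b := .more) (c := .instr .drop)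
    (fun j => ⟨w.drop (w.length - j), [], s⟩) 1 w.length
    (fun j hj => by
      simp only [Test.holds, ne_eq, List.drop_eq_nil_iff, not_le]
      lia) fun j hj => by
      refine (ExecLE.instr .drop _).to ?_
      simp only [Instr.run, List.tail_drop]
      rw [show w.length - (j + 1) + 1 = w.length - j by lia]
  simp only [Nat.sub_self, Nat.sub_zero, List.drop_zero, List.drop_length] at h2
  have h3 := h1.seq h2
  have hsize : w.length = Ctx.size w := by
    change _ = w.length + ∑ i ∈ Finset.range 0, _
    simp
  have h4 := hc w
  beta_reduce at h4
  have h5 : (decide (w ∈ L)).toNat = if w ∈ L then 1 else 0 := by split_ifs with h <;> simp [h]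
  rw [h5]
  refine h3.mono ?_
  rw [← hsize] at h4
  lia

end Closure

/-! ### Reading the encoding of an instance -/

/-- The number of commas in front of position `p`. -/
def commas (w : List Γ') (p : ℕ) : ℕ :=
  ∑ j ∈ Finset.range p, if w[j]? = some Γ'.comma then 1 else 0

/-- The symbol at position `p` is a binary digit. -/
def IsDigitAt (w : List Γ') (p : ℕ) : Prop :=
  w[p]? = some (Γ'.bit true) ∨ w[p]? = some (Γ'.bit false)

instance (w : List Γ') (p : ℕ) : Decidable (IsDigitAt w p) := by
  unfold IsDigitAt
  infer_instance

/-- The word is cut at the commas; `piece w t` consists of the digits between comma `t` and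
comma `t + 1`. -/
def piece (w : List Γ') (t : ℕ) : List Γ' :=
  (List.range w.length).flatMap fun p =>
    if IsDigitAt w p ∧ commas w p = t then w[p]?.toList else []

theorem commas_cons (a : Γ') (w : List Γ') (p : ℕ) :
    commas (a :: w) (p + 1) = commas w p + if a = Γ'.comma then 1 else 0 := by
  unfold commas
  rw [Finset.sum_range_succ']
  simp only [List.getElem?_cons_succ, List.getElem?_cons_zero, Option.some.injEq]

theorem commas_zero (w : List Γ') : commas w 0 = 0 := rfl

theorem piece_cons (a : Γ') (w : List Γ') (t : ℕ) :
    piece (a :: w) t = (if (a = .bit true ∨ a = .bit false) ∧ t = 0 then [a] else []) ++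
      (List.range w.length).flatMap fun p =>
        if IsDigitAt w p ∧ (commas w p + if a = Γ'.comma then 1 else 0) = t then w[p]?.toList
        else [] := by
  rw [piece, List.length_cons, List.range_succ_eq_map, List.flatMap_cons, List.flatMap_map]
  congr 1
  · simp [IsDigitAt, commas_zero, eq_comm]
  · refine List.flatMap_congr fun p _ => ?_
    rw [Nat.succ_eq_add_one, commas_cons]
    rfl

theorem piece_comma_zero (w : List Γ') : piece (.comma :: w) 0 = [] := by
  rw [piece_cons]
  simp

theorem piece_comma_succ (w : List Γ') (t : ℕ) : piece (.comma :: w) (t + 1) = piece w t := by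
  rw [piece_cons]
  simp [piece]

theorem piece_bracket {a : Γ'} (h : a = .bra ∨ a = .ket ∨ a = .blank) (w : List Γ') (t : ℕ) :
    piece (a :: w) t = piece w t := by
  rw [piece_cons]
  rcases h with rfl | rfl | rfl <;> simp [piece]

theorem piece_bit (b : Bool) (w : List Γ') (t : ℕ) :
    piece (.bit b :: w) t = (if t = 0 then [Γ'.bit b] else []) ++ piece w t := by
  rw [piece_cons]
  cases b <;> simp [piece]

theorem piece_bits (l : List Bool) (w : List Γ') (t : ℕ) :
    piece (l.map Γ'.bit ++ w) t = (if t = 0 then l.map Γ'.bit else []) ++ piece w t := by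
  induction l with
  | nil => simp
  | cons b l ih =>
    rw [List.map_cons, List.cons_append, piece_bit, ih]
    split_ifs <;> simp

theorem piece_encNat_comma (n : ℕ) (w : List Γ') (t : ℕ) :
    piece (encNat n ++ Γ'.comma :: w) t = if t = 0 then encNat n else piece w (t - 1) := by
  rw [encNat, piece_bits]
  rcases t with _ | t
  · simp [piece_comma_zero]
  · simp [piece_comma_succ]

theorem piece_nil (t : ℕ) : piece [] t = [] := rfl

theorem piece_encNat (n t : ℕ) : piece (encNat n) t = if t = 0 then encNat n else [] := by
  have := piece_bits (encodeNat n) [] t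
  rwa [List.append_nil, piece_nil, List.append_nil] at this

theorem piece_encList_encNat (l : List ℕ) (w : List Γ') (t : ℕ) :
    piece (encList encNat l ++ w) t =
      if h : t < l.length then encNat l[t] else piece w (t - l.length) := by
  simp only [encList, List.cons_append, List.append_assoc, List.nil_append]
  rw [piece_bracket (.inl rfl)]
  induction l generalizing t with
  | nil => simp [piece_bracket (.inr (.inl rfl))]
  | cons a l ih =>
    simp only [List.flatMap_cons, List.append_assoc, List.cons_append, List.nil_append,
      piece_encNat_comma, ih]
    rcases t with _ | t
    · simp
    · simp

/-- In a list of lists of length `m`, every inner list takes `m + 1` pieces. -/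
theorem piece_encList_encList {m : ℕ} {L : List (List ℕ)} (hL : ∀ l ∈ L, l.length = m)
    (w : List Γ') :
    (∀ r j : ℕ, (hr : r < L.length) → j < m →
      piece (encList (encList encNat) L ++ w) (r * (m + 1) + j) = encNat (L[r].getD j 0)) ∧
    ∀ t, piece (encList (encList encNat) L ++ w) (L.length * (m + 1) + t) = piece w t := by
  have hout : ∀ t, piece (encList (encList encNat) L ++ w) t =
      piece ((L.flatMap fun l => encList encNat l ++ [Γ'.comma]) ++ (Γ'.ket :: w)) t := fun t => by
    rw [encList, List.cons_append, List.cons_append, List.append_assoc,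
      piece_bracket (.inl rfl), List.singleton_append]
  simp only [hout]
  clear hout
  induction L with
  | nil => simp [piece_bracket (.inr (.inl rfl))]
  | cons l L ih =>
    obtain ⟨ih1, ih2⟩ := ih fun x hx => hL x (List.mem_cons_of_mem _ hx)
    have hl : l.length = m := hL l List.mem_cons_self
    simp only [List.flatMap_cons, List.append_assoc, List.cons_append, List.nil_append,
      piece_encList_encNat]
    constructor
    · intro r j hr hj
      rcases r with _ | r
      · have : j < l.length := by lia
        simp [this]
      · have h1 : ¬ (r + 1) * (m + 1) + j < l.length := by lia
        have h2 : (r + 1) * (m + 1) + j - l.length = r * (m + 1) + j + 1 := by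
          rw [Nat.succ_mul]
          lia
        rw [dif_neg h1, h2, piece_comma_succ, ih1 r j (by simpa using hr) hj]
        rfl
    · intro t
      have h1 : ¬ (L.length + 1) * (m + 1) + t < l.length := by
        rw [Nat.succ_mul]
        lia
      have h2 : (L.length + 1) * (m + 1) + t - l.length = L.length * (m + 1) + t + 1 := by
        rw [Nat.succ_mul]
        lia
      rw [List.length_cons, dif_neg h1, h2, piece_comma_succ, ih2]

/-! ### Binary numerals -/

theorem binVal_encNat (n : ℕ) : binVal (encNat n) = n := by
  have hpos : ∀ q : PosNum, binVal ((encodePosNum q).map Γ'.bit) = (q : ℕ) := by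
    intro q
    induction q with
    | one => simp [encodePosNum, binVal]
    | bit1 q ih =>
      rw [encodePosNum, List.map_cons, binVal_cons, ih, PosNum.cast_bit1]
      simp
      ring
    | bit0 q ih =>
      rw [encodePosNum, List.map_cons, binVal_cons, ih, PosNum.cast_bit0]
      simp
      ring
  rw [encNat, encodeNat]
  have h : ((n : Num) : ℕ) = n := Num.to_of_nat n
  cases hn : (n : Num) with
  | zero =>
    rw [hn] at h
    simpa [encodeNum, binVal] using h
  | pos q =>
    rw [hn] at h
    rw [encodeNum, hpos]
    exact h

/-- A digit sequence is a numeral if it does not end with the digit `0`. -/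
theorem encNat_binVal {l : List Bool} (hl : l.getLast? ≠ some false) :
    encNat (binVal (l.map Γ'.bit)) = l.map Γ'.bit := by
  have hpos : ∀ l : List Bool, l ≠ [] → l.getLast? ≠ some false →
      ∃ q : PosNum, encodePosNum q = l := by
    intro l
    induction l with
    | nil => simp
    | cons b l ih =>
      intro _ h
      by_cases hl : l = []
      · subst hl
        cases b
        · simp at h
        · exact ⟨.one, rfl⟩
      · rw [List.getLast?_cons_of_ne_nil hl] at h
        obtain ⟨q, rfl⟩ := ih hl h
        cases b
        · exact ⟨.bit0 q, rfl⟩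
        · exact ⟨.bit1 q, rfl⟩
  obtain ⟨n, hn⟩ : ∃ n : ℕ, encodeNat n = l := by
    by_cases h : l = []
    · exact ⟨0, by rw [h]; rfl⟩
    · obtain ⟨q, rfl⟩ := hpos l h hl
      refine ⟨(q : ℕ), ?_⟩
      rw [encodeNat, PosNum.of_to_nat]
      rfl
  rw [← hn]
  exact congrArg encNat (binVal_encNat n)

theorem exists_piece_eq_map (w : List Γ') (t : ℕ) : ∃ l : List Bool, piece w t = l.map Γ'.bit := by
  induction w generalizing t with
  | nil => exact ⟨[], rfl⟩
  | cons a w ih =>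
    rcases a with _ | b | _ | _ | _
    · rw [piece_bracket (.inr (.inr rfl))]
      exact ih t
    · obtain ⟨l, hl⟩ := ih t
      refine ⟨(if t = 0 then [b] else []) ++ l, ?_⟩
      rw [piece_bit, hl]
      split_ifs <;> simp
    · rw [piece_bracket (.inl rfl)]
      exact ih t
    · rw [piece_bracket (.inr (.inl rfl))]
      exact ih t
    · rcases t with _ | t
      · exact ⟨[], piece_comma_zero w⟩
      · rw [piece_comma_succ]
        exact ih t

theorem getLast?_encNat (n : ℕ) : (encNat n).getLast? ≠ some (Γ'.bit false) := by
  have hpos : ∀ q : PosNum, (encodePosNum q) ≠ [] ∧ (encodePosNum q).getLast? ≠ some false := by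
    intro q
    induction q with
    | one => simp [encodePosNum]
    | bit1 q ih => exact ⟨by simp [encodePosNum], by
        rw [encodePosNum, List.getLast?_cons_of_ne_nil ih.1]; exact ih.2⟩
    | bit0 q ih => exact ⟨by simp [encodePosNum], by
        rw [encodePosNum, List.getLast?_cons_of_ne_nil ih.1]; exact ih.2⟩
  rw [encNat, encodeNat, List.getLast?_map]
  cases (n : Num) with
  | zero => simp [encodeNum]
  | pos q =>
    rw [encodeNum, ne_eq, Option.map_eq_some_iff]
    rintro ⟨b, hb, hb'⟩
    exact (hpos q).2 (by simpa [Γ'.bit.inj hb'] using hb)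

/-- Every piece of the word is a binary numeral. -/
def AllNumerals (w : List Γ') : Prop := ∀ t, ∃ n, piece w t = encNat n

theorem allNumerals_encNat (n : ℕ) : AllNumerals (encNat n) := fun t => by
  rw [piece_encNat]
  split_ifs
  · exact ⟨n, rfl⟩
  · exact ⟨0, rfl⟩

theorem AllNumerals.comma {w : List Γ'} (h : AllNumerals w) : AllNumerals (Γ'.comma :: w)
  | 0 => ⟨0, piece_comma_zero w⟩
  | t + 1 => piece_comma_succ w t ▸ h t

theorem AllNumerals.bracket {w : List Γ'} (h : AllNumerals w) {a : Γ'} (ha : a = .bra ∨ a = .ket) :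
    AllNumerals (a :: w) := fun t => by
  rw [piece_bracket (by tauto)]
  exact h t

theorem AllNumerals.encNat_comma {w : List Γ'} (h : AllNumerals w) (n : ℕ) :
    AllNumerals (encNat n ++ Γ'.comma :: w) := fun t => by
  rw [piece_encNat_comma]
  split_ifs
  · exact ⟨n, rfl⟩
  · exact h _

theorem AllNumerals.encList {w : List Γ'} (h : AllNumerals w) {β : Type} {f : β → List Γ'}
    (hf : ∀ (b : β) (w : List Γ'), AllNumerals w → AllNumerals (f b ++ Γ'.comma :: w))
    (l : List β) : AllNumerals (_root_.encList f l ++ w) := by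
  rw [_root_.encList, List.cons_append, List.cons_append, List.append_assoc]
  refine AllNumerals.bracket ?_ (.inl rfl)
  induction l with
  | nil => exact h.bracket (.inr rfl)
  | cons b l ih =>
    rw [List.flatMap_cons, List.append_assoc, List.append_assoc]
    exact hf b _ ih

theorem ControlData.allNumerals_encode (I : ControlData) : AllNumerals I.encode := by
  have h1 : AllNumerals (encNat I.target ++ Γ'.comma :: encNat I.limit) :=
    (allNumerals_encNat _).encNat_comma _
  have h2 : ∀ (l : List ℕ) (w : List Γ'), AllNumerals w →
      AllNumerals (encList encNat l ++ Γ'.comma :: w) := fun l w hw =>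
    hw.comma.encList (fun b w hw => hw.encNat_comma b) l
  have := ((h1.encList h2 I.unreg).encList h2 I.votes).encList
    (fun b w hw => hw.encNat_comma b) I.cands
  simpa [ControlData.encode] using this

/-! ### Recognizing the encodings of instances -/

section Shape

variable (w : List Γ') (m nV nU : ℕ)

/-- The piece of the word that holds entry `j` of vote `r`, if there are `m` candidates. -/
def entryIdx (m r j : ℕ) : ℕ := m + (r * (m + 1) + j)

/-- The piece of the word that holds the distinguished candidate; the addition limit follows. -/
def targetIdx (m nV nU : ℕ) : ℕ := m + (nV + nU) * (m + 1)

/-- The pieces `g 0, …, g (n - 1)` as an encoded list. -/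
def encRange (n : ℕ) (g : ℕ → List Γ') : List Γ' :=
  [Γ'.bra] ++ (List.range n).flatMap (fun j => g j ++ [Γ'.comma]) ++ [Γ'.ket]

/-- The word put together again from its pieces. -/
def reassemble : List Γ' :=
  encRange m (piece w) ++
    encRange nV (fun r => encRange m fun j => piece w (entryIdx m r j)) ++
    encRange nU (fun r => encRange m fun j => piece w (entryIdx m (nV + r) j)) ++
    piece w (targetIdx m nV nU) ++ [Γ'.comma] ++ piece w (targetIdx m nV nU + 1)

/-- The data that are read from the word, if there are `m` candidates, `nV` registered and `nU`
unregistered votes. -/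
def readData : ControlData where
  cands := (List.range m).map fun a => binVal (piece w a)
  votes := (List.range nV).map fun r =>
    (List.range m).map fun j => binVal (piece w (entryIdx m r j))
  unreg := (List.range nU).map fun r =>
    (List.range m).map fun j => binVal (piece w (entryIdx m (nV + r) j))
  target := binVal (piece w (targetIdx m nV nU))
  limit := binVal (piece w (targetIdx m nV nU + 1))

/-- The word is the encoding of the data that are read from it. -/
def Reads : Prop :=
  (∀ t < targetIdx m nV nU + 2, (piece w t)[(piece w t).length - 1]? ≠ some (Γ'.bit false)) ∧
    reassemble w m nV nU = w

variable {w m nV nU}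

theorem Reads.encNat_binVal (h : Reads w m nV nU) {t : ℕ} (ht : t < targetIdx m nV nU + 2) :
    encNat (binVal (piece w t)) = piece w t := by
  obtain ⟨l, hl⟩ := exists_piece_eq_map w t
  have := h.1 t ht
  rw [hl, List.length_map, List.getElem?_map] at this
  rw [hl, _root_.encNat_binVal]
  intro h
  rw [List.getLast?_eq_getElem?] at h
  exact this (by rw [h]; rfl)

theorem entryIdx_lt {m r n j : ℕ} (hr : r < n) (hj : j < m) : entryIdx m r j < m + n * (m + 1) := by
  have : (r + 1) * (m + 1) ≤ n * (m + 1) := Nat.mul_le_mul_right _ hr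
  rw [Nat.succ_mul] at this
  unfold entryIdx
  lia

theorem encList_map_range {β : Type} (f : β → List Γ') (n : ℕ) (g : ℕ → β) :
    encList f ((List.range n).map g) = encRange n fun j => f (g j) := by
  rw [encList, encRange, List.flatMap_map]
  rfl

theorem encRange_congr {n : ℕ} {g g' : ℕ → List Γ'} (h : ∀ j < n, g j = g' j) :
    encRange n g = encRange n g' := by
  rw [encRange, encRange, List.flatMap_congr fun j hj => by rw [h j (List.mem_range.1 hj)]]

theorem encode_readData_eq_reassemble
    (key : ∀ t < targetIdx m nV nU + 2, encNat (binVal (piece w t)) = piece w t) :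
    (readData w m nV nU).encode = reassemble w m nV nU := by
  have hT : ∀ r < nV + nU, ∀ j < m, entryIdx m r j < targetIdx m nV nU + 2 := fun r hr j hj =>
    (entryIdx_lt hr hj).trans (by unfold targetIdx; lia)
  have hm : ∀ a < m, a < targetIdx m nV nU + 2 := fun a ha => by unfold targetIdx; lia
  simp only [ControlData.encode, readData, reassemble, encList_map_range]
  rw [key _ (by lia), key _ (by lia), encRange_congr fun j hj => key _ (hm j hj),
    encRange_congr fun r hr => encRange_congr fun j hj => key _ (hT r (by lia) j hj),
    encRange_congr fun r hr => encRange_congr fun j hj => key _ (hT (nV + r) (by lia) j hj)]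

theorem Reads.encode_readData (h : Reads w m nV nU) : (readData w m nV nU).encode = w :=
  (encode_readData_eq_reassemble fun _ ht => h.encNat_binVal ht).trans h.2

end Shape

/-- Data whose votes have as many entries as there are candidates can be read from their
encoding. -/
theorem ControlData.reads_encode (I : ControlData)
    (h : ∀ v ∈ I.votes ++ I.unreg, v.length = I.cands.length) :
    Reads I.encode I.cands.length I.votes.length I.unreg.length ∧
      readData I.encode I.cands.length I.votes.length I.unreg.length = I := by
  set m := I.cands.length with hm
  set nV := I.votes.length with hnV
  set nU := I.unreg.length with hnU
  have hw : I.encode = encList encNat I.cands ++ (encList (encList encNat) I.votes ++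
    (encList (encList encNat) I.unreg ++ (encNat I.target ++ Γ'.comma :: encNat I.limit))) := by
    simp [ControlData.encode]
  have hV := piece_encList_encList (L := I.votes) (m := m) fun v hv => h v (by simp [hv])
  have hU := piece_encList_encList (L := I.unreg) (m := m) fun v hv => h v (by simp [hv])
  have p1 : ∀ a (ha : a < m), piece I.encode a = encNat I.cands[a] := fun a ha => by
    rw [hw, piece_encList_encNat, dif_pos ha]
  have p1' : ∀ t, piece I.encode (m + t) = piece (encList (encList encNat) I.votes ++
    (encList (encList encNat) I.unreg ++ (encNat I.target ++ Γ'.comma :: encNat I.limit))) t :=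
    fun t => by
      rw [hw, piece_encList_encNat, dif_neg (by lia), ← hm, Nat.add_sub_cancel_left]
  have p2 : ∀ r (hr : r < nV), ∀ j < m, piece I.encode (entryIdx m r j) =
      encNat (I.votes[r].getD j 0) := fun r hr j hj => by
    rw [entryIdx, p1', (hV _).1 r j hr hj]
  have p3 : ∀ r (hr : r < nU), ∀ j < m, piece I.encode (entryIdx m (nV + r) j) =
      encNat (I.unreg[r].getD j 0) := fun r hr j hj => by
    rw [entryIdx, p1', add_mul, add_assoc, (hV _).2, (hU _).1 r j hr hj]
  have p4 : ∀ t, piece I.encode (targetIdx m nV nU + t) =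
      piece (encNat I.target ++ Γ'.comma :: encNat I.limit) t := fun t => by
    rw [targetIdx, add_assoc, p1', add_mul, add_assoc, (hV _).2, (hU _).2]
  have p5 : piece I.encode (targetIdx m nV nU) = encNat I.target := by
    have := p4 0
    rwa [piece_encNat_comma, if_pos rfl] at this
  have p6 : piece I.encode (targetIdx m nV nU + 1) = encNat I.limit := by
    rw [p4, piece_encNat_comma, if_neg one_ne_zero, Nat.sub_self, piece_encNat, if_pos rfl]
  have hread : readData I.encode m nV nU = I := by
    rcases I with ⟨cands, votes, unreg, target, limit⟩
    simp only [readData]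
    congr 1
    · refine List.ext_getElem (by simp [hm]) fun a h1 h2 => ?_
      simp [p1 a h2, binVal_encNat]
    · refine List.ext_getElem (by simp [hnV]) fun r h1 h2 => ?_
      have hlen : votes[r].length = m := h _ (by simp)
      simp only [List.getElem_map, List.getElem_range]
      refine List.ext_getElem (by simp [hlen]) fun j h3 h4 => ?_
      simp only [List.getElem_map, List.getElem_range]
      rw [p2 r h2 j (by lia), binVal_encNat]
      simp [h4]
    · refine List.ext_getElem (by simp [hnU]) fun r h1 h2 => ?_
      have hlen : unreg[r].length = m := h _ (by simp)
      simp only [List.getElem_map, List.getElem_range]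
      refine List.ext_getElem (by simp [hlen]) fun j h3 h4 => ?_
      simp only [List.getElem_map, List.getElem_range]
      rw [p3 r h2 j (by lia), binVal_encNat]
      simp [h4]
    · rw [p5, binVal_encNat]
    · rw [p6, binVal_encNat]
  have key : ∀ t, encNat (binVal (piece I.encode t)) = piece I.encode t := fun t => by
    obtain ⟨n, hn⟩ := I.allNumerals_encode t
    rw [hn, binVal_encNat]
  refine ⟨⟨fun t _ => ?_, ?_⟩, hread⟩
  · rw [← key t, ← List.getLast?_eq_getElem?]
    exact getLast?_encNat _
  · rw [← encode_readData_eq_reassemble fun t _ => key t, hread]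

/-! ### Instances as conditions on pieces -/

theorem List.nodup_map_range_iff {β : Type*} {m : ℕ} {f : ℕ → β} :
    ((List.range m).map f).Nodup ↔ ∀ a < m, ∀ b < m, f a = f b → a = b := by
  rw [List.nodup_map_iff_inj_on List.nodup_range]
  simp only [List.mem_range]

theorem List.perm_map_range_iff {β : Type*} {m : ℕ} {f g : ℕ → β}
    (hg : ((List.range m).map g).Nodup) :
    ((List.range m).map f).Perm ((List.range m).map g) ↔
      (∀ j < m, ∀ j' < m, f j = f j' → j = j') ∧ ∀ j < m, ∃ a < m, f j = g a := by
  rw [← List.nodup_map_range_iff]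
  constructor
  · refine fun h => ⟨h.nodup_iff.2 hg, fun j hj => ?_⟩
    have := h.subset (List.mem_map_of_mem (List.mem_range.2 hj))
    obtain ⟨a, ha, he⟩ := List.mem_map.1 this
    exact ⟨a, List.mem_range.1 ha, he.symm⟩
  · rintro ⟨h1, h2⟩
    refine (List.subperm_of_subset h1 fun x hx => ?_).perm_of_length_le (by simp)
    obtain ⟨j, hj, rfl⟩ := List.mem_map.1 hx
    obtain ⟨a, ha, he⟩ := h2 j (List.mem_range.1 hj)
    exact he ▸ List.mem_map_of_mem (List.mem_range.2 ha)

/-- The index of the first occurrence of `x` is the number of initial segments without `x`. -/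
theorem List.idxOf_map_range {β : Type*} [DecidableEq β] (x : β) (m : ℕ) (f : ℕ → β) :
    ((List.range m).map f).idxOf x =
      ∑ j ∈ Finset.range m, if ∀ j' < j + 1, f j' ≠ x then 1 else 0 := by
  induction m with
  | zero => rfl
  | succ m ih =>
    rw [List.range_succ, List.map_append, Finset.sum_range_succ, ← ih, List.idxOf_append]
    have hmem : x ∈ (List.range m).map f ↔ ∃ j < m, f j = x := by simp
    by_cases h : x ∈ (List.range m).map f
    · obtain ⟨j, hj, he⟩ := hmem.1 h
      rw [if_pos h, if_neg fun h' => h' j (by lia) he, add_zero]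
    · rw [if_neg h, List.length_map, List.length_range, List.idxOf_of_notMem h, List.length_map,
        List.length_range, List.map_singleton]
      by_cases hm : f m = x
      · rw [if_neg fun h' => h' m (by lia) hm]
        simp [hm]
      · rw [if_pos]
        · simp [hm, add_comm]
        · intro j hj he
          rcases Nat.lt_succ_iff_lt_or_eq.1 hj with hj | rfl
          · exact h (hmem.2 ⟨j, hj, he⟩)
          · exact hm he

/-- The position of candidate `a` in vote `r`, read from the word. -/
def readPos (w : List Γ') (m r a : ℕ) : ℕ :=
  (∑ j ∈ Finset.range m, if ∀ j' < j + 1, piece w (entryIdx m r j') ≠ piece w a then 1 else 0) + 1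

/-- The word encodes an instance with `m` candidates, `nV` registered and `nU` unregistered votes,
and the distinguished candidate is the one with index `c`. -/
def ReadsInstance (w : List Γ') (m nV nU c : ℕ) : Prop :=
  Reads w m nV nU ∧ (∀ a < m, ∀ b < m, piece w a = piece w b → a = b) ∧
    (∀ r < nV + nU,
      (∀ j < m, ∀ j' < m, piece w (entryIdx m r j) = piece w (entryIdx m r j') → j = j') ∧
        ∀ j < m, ∃ a < m, piece w (entryIdx m r j) = piece w a) ∧
    piece w (targetIdx m nV nU) = piece w c

section Shape

variable {w : List Γ'} {m nV nU : ℕ}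

theorem Reads.binVal_eq_iff (h : Reads w m nV nU) {t t' : ℕ} (ht : t < targetIdx m nV nU + 2)
    (ht' : t' < targetIdx m nV nU + 2) :
    binVal (piece w t) = binVal (piece w t') ↔ piece w t = piece w t' :=
  ⟨fun he => by rw [← h.encNat_binVal ht, he, h.encNat_binVal ht'], fun he => by rw [he]⟩

theorem entryIdx_lt_targetIdx {r j : ℕ} (hr : r < nV + nU) (hj : j < m) :
    entryIdx m r j < targetIdx m nV nU + 2 :=
  (entryIdx_lt hr hj).trans (by unfold targetIdx; lia)

theorem lt_targetIdx {a : ℕ} (ha : a < m) : a < targetIdx m nV nU + 2 := by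
  unfold targetIdx
  lia

theorem mem_votes_readData {v : List ℕ} :
    v ∈ (readData w m nV nU).votes ++ (readData w m nV nU).unreg ↔
      ∃ r < nV + nU, v = (List.range m).map fun j => binVal (piece w (entryIdx m r j)) := by
  simp only [readData, List.mem_append, List.mem_map, List.mem_range]
  constructor
  · rintro (⟨r, hr, rfl⟩ | ⟨r, hr, rfl⟩)
    · exact ⟨r, by lia, rfl⟩
    · exact ⟨nV + r, by lia, rfl⟩
  · rintro ⟨r, hr, rfl⟩
    rcases lt_or_ge r nV with h | h
    · exact .inl ⟨r, h, rfl⟩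
    · exact .inr ⟨r - nV, by lia, by rw [Nat.add_sub_cancel' h]⟩

theorem Reads.isInstance_iff (h : Reads w m nV nU) :
    (readData w m nV nU).IsInstance ↔ ∃ c < m, ReadsInstance w m nV nU c := by
  have hC : (readData w m nV nU).cands.Nodup ↔ ∀ a < m, ∀ b < m, piece w a = piece w b → a = b := by
    rw [readData, List.nodup_map_range_iff]
    refine forall₂_congr fun a ha => forall₂_congr fun b hb => ?_
    rw [h.binVal_eq_iff (lt_targetIdx ha) (lt_targetIdx hb)]
  have hT : (readData w m nV nU).target ∈ (readData w m nV nU).cands ↔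
      ∃ c < m, piece w (targetIdx m nV nU) = piece w c := by
    simp only [readData, List.mem_map, List.mem_range]
    refine exists_congr fun c => and_congr_right fun hc => ?_
    rw [h.binVal_eq_iff (lt_targetIdx hc) (by lia), eq_comm]
  have hV : (readData w m nV nU).cands.Nodup →
      (((∀ v ∈ (readData w m nV nU).votes, v.Perm (readData w m nV nU).cands) ∧
        ∀ v ∈ (readData w m nV nU).unreg, v.Perm (readData w m nV nU).cands) ↔
      ∀ r < nV + nU,
      (∀ j < m, ∀ j' < m, piece w (entryIdx m r j) = piece w (entryIdx m r j') → j = j') ∧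
        ∀ j < m, ∃ a < m, piece w (entryIdx m r j) = piece w a) := by
    intro hnd
    rw [← List.forall_mem_append]
    trans ∀ r < nV + nU, ((List.range m).map fun j => binVal (piece w (entryIdx m r j))).Perm
      (readData w m nV nU).cands
    · exact ⟨fun h r hr => h _ (mem_votes_readData.2 ⟨r, hr, rfl⟩), fun h v hv => by
        obtain ⟨r, hr, rfl⟩ := mem_votes_readData.1 hv
        exact h r hr⟩
    · refine forall₂_congr fun r hr => (List.perm_map_range_iff hnd).trans (and_congr ?_ ?_)
      · refine forall₂_congr fun j hj => forall₂_congr fun j' hj' => ?_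
        rw [h.binVal_eq_iff (entryIdx_lt_targetIdx hr hj) (entryIdx_lt_targetIdx hr hj')]
      · refine forall₂_congr fun j hj => exists_congr fun a => and_congr_right fun ha => ?_
        rw [h.binVal_eq_iff (entryIdx_lt_targetIdx hr hj) (lt_targetIdx ha)]
  unfold ControlData.IsInstance ReadsInstance
  rw [hT, ← and_assoc (a := ∀ v ∈ (readData w m nV nU).votes, _)]
  constructor
  · rintro ⟨h1, h2, c, hc, h3⟩
    exact ⟨c, hc, h, hC.1 h1, (hV h1).1 h2, h3⟩
  · rintro ⟨c, hc, -, h1, h2, h3⟩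
    exact ⟨hC.2 h1, (hV (hC.2 h1)).2 h2, c, hc, h3⟩

theorem Reads.position_readData (h : Reads w m nV nU) {r a : ℕ} (hr : r < nV + nU) (ha : a < m) :
    (readData w m nV nU).position r a = readPos w m r a := by
  have h1 : ((readData w m nV nU).votes ++ (readData w m nV nU).unreg).getD r [] =
      (List.range m).map fun j => binVal (piece w (entryIdx m r j)) := by
    simp only [readData]
    rcases lt_or_ge r nV with h | h
    · rw [List.getD_append _ _ _ _ (by simpa using h)]
      simp [h]
    · rw [List.getD_append_right _ _ _ _ (by simpa using h)]
      have : r - nV < nU := by lia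
      simp [this, Nat.add_sub_cancel' h]
  have h2 : (readData w m nV nU).cands.getD a 0 = binVal (piece w a) := by
    simp [readData, ha]
  rw [ControlData.position, h1, h2, pos, List.idxOf_map_range, readPos]
  congr 1
  refine Finset.sum_congr rfl fun j hj =>
    if_congr (forall₂_congr fun j' hj' => not_congr ?_) rfl rfl
  have := Finset.mem_range.1 hj
  exact h.binVal_eq_iff (entryIdx_lt_targetIdx hr (by lia)) (lt_targetIdx ha)

end Shape

/-! ### Yes-instances as conditions on words -/

theorem Spoils.congr {p p' : ℕ → ℕ → ℕ} {nV nU B m c d i : ℕ} {A : Finset ℕ}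
    (hA : A ⊆ Finset.range nU) (hp : ∀ r < nV + nU, p r c = p' r c ∧ p r d = p' r d)
    (h : Spoils p nV B m c d i A) : Spoils p' nV B m c d i A := by
  have hs : ∀ a, a = c ∨ a = d → ∀ j, tableScore p nV A j a = tableScore p' nV A j a ∧
      tableWeight p nV B A j a = tableWeight p' nV B A j a := by
    intro a ha j
    have h1 : ∀ r < nV + nU, p r a = p' r a := fun r hr => by
      rcases ha with rfl | rfl
      · exact (hp r hr).1
      · exact (hp r hr).2
    have h2 : ∀ r ∈ Finset.range nV, p r a = p' r a := fun r hr =>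
      h1 r (by have := Finset.mem_range.1 hr; lia)
    have h3 : ∀ u ∈ A, p (nV + u) a = p' (nV + u) a := fun u hu =>
      h1 _ (by have := Finset.mem_range.1 (hA hu); lia)
    unfold tableScore tableWeight voteWeight
    exact ⟨congrArg₂ _ (Finset.sum_congr rfl fun r hr => by rw [h2 r hr])
      (Finset.sum_congr rfl fun u hu => by rw [h3 u hu]),
      congrArg₂ _ (Finset.sum_congr rfl fun r hr => by rw [h2 r hr])
      (Finset.sum_congr rfl fun u hu => by rw [h3 u hu])⟩
  unfold Spoils at *
  simpa only [(hs c (.inl rfl) _).1, (hs d (.inr rfl) _).1, (hs c (.inl rfl) _).2,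
    (hs d (.inr rfl) _).2] using h

/-- A weight that exceeds every sum of positions. -/
def posBound (m nV nU : ℕ) : ℕ := (nV + nU) * m + m + 1

theorem length_le_encList {β : Type} (f : β → List Γ') (l : List β) :
    l.length ≤ (encList f l).length := by
  induction l with
  | nil => exact Nat.zero_le _
  | cons a l ih =>
    simp only [encList, List.cons_append, List.length_cons, List.flatMap_cons, List.length_append,
      List.length_nil] at ih ⊢
    lia

/-- The condition on `w` to encode a yes-instance with `m` candidates, `nV` registered and `nU`
unregistered votes, and with the distinguished candidate at index `c`; the addition limit is capped
by the number of unregistered votes. -/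
def ReadsYes (w : List Γ') (m nV nU c : ℕ) : Prop :=
  (nV = 0 ∧ 2 ≤ m) ∨ ∃ d < m, d ≠ c ∧ ∃ i < m + 1, 1 ≤ i ∧
    ∃ q₀ < nU + 1, ∃ q₁ < nU + 1, ∃ q₂ < nU + 1, ∃ q₃ < nU + 1,
      (bestVotes (readPos w m) nV nU (posBound m nV nU) m c d i (quotas q₀ q₁ q₂ q₃)).card ≤
          min nU (binVal (piece w (targetIdx m nV nU + 1))) ∧
        Spoils (readPos w m) nV (posBound m nV nU) m c d i
          (bestVotes (readPos w m) nV nU (posBound m nV nU) m c d i (quotas q₀ q₁ q₂ q₃))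

theorem ReadsInstance.readsYes_iff {w : List Γ'} {m nV nU c : ℕ} (hc : c < m)
    (h : ReadsInstance w m nV nU c) :
    (readData w m nV nU).DestructiveAddVoters sksWinners ↔ ReadsYes w m nV nU c := by
  have hr := h.1
  have hI := hr.isInstance_iff.2 ⟨c, hc, h⟩
  have hm : (readData w m nV nU).cands.length = m := by simp [readData]
  have hV : (readData w m nV nU).votes.length = nV := by simp [readData]
  have hU : (readData w m nV nU).unreg.length = nU := by simp [readData]
  have hct : (readData w m nV nU).cands.getD c 0 = (readData w m nV nU).target := by
    simp [readData, hc, h.2.2.2]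
  have := destructiveAddVoters_iff hI (c := c) (by rwa [hm]) hct (B := posBound m nV nU)
    (by rw [hm, hV, hU, posBound]; lia) (by rw [hm, posBound]; lia)
  rw [hm, hV, hU] at this
  rw [this, ReadsYes]
  refine or_congr_right (exists_congr fun d => and_congr_right fun hd => and_congr_right fun _ =>
    exists_congr fun i => and_congr_right fun _ => and_congr_right fun _ => ?_)
  rw [← exists_spoils_iff]
  refine exists_congr fun A => and_congr_right fun hA => and_congr ?_ ?_
  · have : A.card ≤ nU := by simpa using Finset.card_le_card hA
    rw [le_min_iff]
    exact ⟨fun h => ⟨this, h⟩, fun h => h.2⟩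
  · have hp : ∀ r < nV + nU, ∀ a < m, (readData w m nV nU).position r a = readPos w m r a :=
      fun r hr' a ha => hr.position_readData hr' ha
    exact ⟨Spoils.congr hA fun r hr => ⟨hp r hr c hc, hp r hr d hd⟩,
      Spoils.congr hA fun r hr => ⟨(hp r hr c hc).symm, (hp r hr d hd).symm⟩⟩

/-- Since the word is at least as long as the lists that it encodes, the numbers of candidates and
votes can be searched for. -/
theorem mem_DCAV_iff {w : List Γ'} :
    w ∈ DCAV sksWinners ↔ ∃ m < w.length + 1, ∃ nV < w.length + 1, ∃ nU < w.length + 1, ∃ c < m,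
      ReadsInstance w m nV nU c ∧ ReadsYes w m nV nU c := by
  constructor
  · rintro ⟨I, hI, rfl, hD⟩
    obtain ⟨h1, h2⟩ := I.reads_encode fun v hv => by
      rcases List.mem_append.1 hv with hv | hv
      · exact (hI.2.1 v hv).length_eq
      · exact (hI.2.2.1 v hv).length_eq
    have h3 := length_le_encList encNat I.cands
    have h4 := length_le_encList (encList encNat) I.votes
    have h5 := length_le_encList (encList encNat) I.unreg
    have hlen : I.cands.length < I.encode.length + 1 ∧ I.votes.length < I.encode.length + 1 ∧
        I.unreg.length < I.encode.length + 1 := by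
      simp only [ControlData.encode, List.length_append]
      lia
    rw [← h2, h1.isInstance_iff] at hI
    obtain ⟨c, hc, hI⟩ := hI
    refine ⟨_, hlen.1, _, hlen.2.1, _, hlen.2.2, c, hc, hI, ?_⟩
    rw [← hI.readsYes_iff hc, h2]
    exact hD
  · rintro ⟨m, -, nV, -, nU, -, c, hc, hI, hy⟩
    exact ⟨readData w m nV nU, hI.1.isInstance_iff.2 ⟨c, hc, hI⟩, hI.1.encode_readData,
      (hI.readsYes_iff hc).2 hy⟩

section Membership

variable {X Y : Type} [Ctx X] [Ctx Y]

/-! ### Reading the encoding in polynomial time -/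

theorem PT.commas {f : X → ℕ} (hf : PT f) : PT fun x => commas (inp x) (f x) :=
  PT.sum (g := fun x j => if (inp x)[j]? = some Γ'.comma then 1 else 0) hf
    (PTPred.symbol (X := X × ℕ) PT.var _).toPT

theorem PTPred.isDigitAt {f : X → ℕ} (hf : PT f) : PTPred fun x => IsDigitAt (inp x) (f x) :=
  (PTPred.symbol hf _).or (PTPred.symbol hf _)

theorem PTWord.symbol {f : X → ℕ} (hf : PT f) : PTWord fun x => (Ctx.inp x)[f x]?.toList := by
  refine ⟨(PTPred.lt hf .length).toPT.congr fun x => ?_, fun a => ?_⟩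
  · split_ifs with h <;> simp [h]
  · refine ((PTPred.eq PT.var PT.zero).and (PTPred.symbol (X := X × ℕ) hf.wk a)).congr fun q => ?_
    change q.2 = 0 ∧ (Ctx.inp q.1)[f q.1]? = some a ↔
      (Ctx.inp q.1)[f q.1]?.toList[q.2]? = some a
    cases (Ctx.inp q.1)[f q.1]? <;> rcases q.2 with _ | n <;> simp

theorem PTWord.piece {f : X → ℕ} (hf : PT f) : PTWord fun x => piece (Ctx.inp x) (f x) :=
  PTWord.flatMap (g := fun x p =>
    if IsDigitAt (Ctx.inp x) p ∧ _root_.commas (Ctx.inp x) p = f x then (Ctx.inp x)[p]?.toList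
    else []) .length
    (.ite ((PTPred.isDigitAt (X := X × ℕ) PT.var).and
      (PTPred.eq (PT.commas (X := X × ℕ) PT.var) hf.wk)) (.symbol (X := X × ℕ) PT.var) .nil)

theorem PTWord.encRange {n : X → ℕ} {g : X → ℕ → List Γ'} (hn : PT n)
    (hg : PTWord fun p : X × ℕ => g p.1 p.2) : PTWord fun x => encRange (n x) (g x) :=
  ((PTWord.singleton _).append (PTWord.flatMap (g := fun x j => g x j ++ [Γ'.comma]) hn
    (hg.append (.singleton _)))).append (.singleton _)

theorem PT.entryIdx {m r j : X → ℕ} (hm : PT m) (hr : PT r) (hj : PT j) :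
    PT fun x => entryIdx (m x) (r x) (j x) :=
  hm.add ((hr.mul hm.succ).add hj)

theorem PT.targetIdx {m nV nU : X → ℕ} (hm : PT m) (hV : PT nV) (hU : PT nU) :
    PT fun x => targetIdx (m x) (nV x) (nU x) :=
  hm.add ((hV.add hU).mul hm.succ)

variable {m nV nU : X → ℕ}

theorem PTWord.reassemble (hm : PT m) (hV : PT nV) (hU : PT nU) :
    PTWord fun x => reassemble (Ctx.inp x) (m x) (nV x) (nU x) := by
  have hT := PT.targetIdx hm hV hU
  refine (((((PTWord.encRange (g := fun x => _root_.piece (Ctx.inp x)) hm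
    (.piece (X := X × ℕ) PT.var)).append
    (.encRange (g := fun x r => _root_.encRange (m x) fun j =>
      _root_.piece (Ctx.inp x) (entryIdx (m x) r j)) hV
      (.encRange (g := fun (q : X × ℕ) j => _root_.piece (Ctx.inp q) (entryIdx (m q.1) q.2 j)) hm.wk
        (.piece (X := (X × ℕ) × ℕ) (.entryIdx hm.wk.wk PT.var.wk PT.var))))).append
    (.encRange (g := fun x r => _root_.encRange (m x) fun j =>
      _root_.piece (Ctx.inp x) (entryIdx (m x) (nV x + r) j)) hU
      (.encRange (g := fun (q : X × ℕ) j =>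
        _root_.piece (Ctx.inp q) (entryIdx (m q.1) (nV q.1 + q.2) j))
        hm.wk (.piece (X := (X × ℕ) × ℕ)
          (.entryIdx hm.wk.wk (hV.wk.wk.add PT.var.wk) PT.var))))).append
    (.piece hT)).append (.singleton _)).append (.piece hT.succ)

theorem PTPred.reads (hm : PT m) (hV : PT nV) (hU : PT nU) :
    PTPred fun x => Reads (inp x) (m x) (nV x) (nU x) := by
  have hP : PTWord fun q : X × ℕ => piece (inp q) q.2 := .piece PT.var
  exact (PTPred.forall_lt (p := fun x t =>
    (piece (inp x) t)[(piece (inp x) t).length - 1]? ≠ some (Γ'.bit false))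
    (PT.targetIdx hm hV hU).succ.succ (hP.get hP.1.pred _).not).and
      (PTWord.eq (.reassemble hm hV hU) .inp)

theorem PT.readPos {r a : X → ℕ} (hm : PT m) (hr : PT r) (ha : PT a) :
    PT fun x => readPos (inp x) (m x) (r x) (a x) :=
  (PT.sum (g := fun x j => if ∀ j' < j + 1,
    piece (inp x) (_root_.entryIdx (m x) (r x) j') ≠ piece (inp x) (a x) then 1 else 0) hm
    (PTPred.toPT (PTPred.forall_lt (p := fun (q : X × ℕ) j' =>
      piece (inp q) (_root_.entryIdx (m q.1) (r q.1) j') ≠ piece (inp q) (a q.1)) PT.var.succ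
      (PTWord.eq (.piece (X := (X × ℕ) × ℕ) (.entryIdx hm.wk.wk hr.wk.wk PT.var))
        (.piece (X := (X × ℕ) × ℕ) ha.wk.wk)).not))).succ

theorem PTPred.readsInstance {c : X → ℕ} (hm : PT m) (hV : PT nV) (hU : PT nU) (hc : PT c) :
    PTPred fun x => ReadsInstance (inp x) (m x) (nV x) (nU x) (c x) := by
  refine (PTPred.reads hm hV hU).and (.and ?_ (.and ?_ ?_))
  · refine PTPred.forall_lt (p := fun x a => ∀ b < m x, piece (inp x) a = piece (inp x) b → a = b)
      hm (PTPred.forall_lt (p := fun (q : X × ℕ) b => piece (inp q) q.2 = piece (inp q) b → q.2 = b)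
        hm.wk (.imp ?_ (.eq PT.var.wk PT.var)))
    exact PTWord.eq (.piece (X := (X × ℕ) × ℕ) PT.var.wk) (.piece (X := (X × ℕ) × ℕ) PT.var)
  · refine PTPred.forall_lt (p := fun x r => (∀ j < m x, ∀ j' < m x,
      piece (inp x) (entryIdx (m x) r j) = piece (inp x) (entryIdx (m x) r j') → j = j') ∧
        ∀ j < m x, ∃ a < m x, piece (inp x) (entryIdx (m x) r j) = piece (inp x) a) (hV.add hU)
      (.and ?_ ?_)
    · refine PTPred.forall_lt (p := fun (q : X × ℕ) j => ∀ j' < m q.1, piece (inp q)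
        (entryIdx (m q.1) q.2 j) = piece (inp q) (entryIdx (m q.1) q.2 j') → j = j') hm.wk
        (PTPred.forall_lt (p := fun (q : (X × ℕ) × ℕ) j' => piece (inp q)
          (entryIdx (m q.1.1) q.1.2 q.2) = piece (inp q) (entryIdx (m q.1.1) q.1.2 j') → q.2 = j')
          hm.wk.wk (.imp ?_ (.eq PT.var.wk PT.var)))
      exact PTWord.eq
        (.piece (X := ((X × ℕ) × ℕ) × ℕ) (.entryIdx hm.wk.wk.wk PT.var.wk.wk PT.var.wk))
        (.piece (X := ((X × ℕ) × ℕ) × ℕ) (.entryIdx hm.wk.wk.wk PT.var.wk.wk PT.var))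
    · refine PTPred.forall_lt (p := fun (q : X × ℕ) j => ∃ a < m q.1, piece (inp q)
        (entryIdx (m q.1) q.2 j) = piece (inp q) a) hm.wk
        (PTPred.exists_lt (p := fun (q : (X × ℕ) × ℕ) a => piece (inp q)
          (entryIdx (m q.1.1) q.1.2 q.2) = piece (inp q) a) hm.wk.wk ?_)
      exact PTWord.eq
        (.piece (X := ((X × ℕ) × ℕ) × ℕ) (.entryIdx hm.wk.wk.wk PT.var.wk.wk PT.var.wk))
        (.piece (X := ((X × ℕ) × ℕ) × ℕ) PT.var)
  · exact PTWord.eq (.piece (.targetIdx hm hV hU)) (.piece hc)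

/-! ### The greedy selection in polynomial time -/

/-- Lexicographic comparison of differences of computable functions; the differences are moved to
the other sides, as `PT` only has natural numbers. -/
theorem PTPred.lexGe {i : X → ℕ} {f f' g g' : X → ℕ → ℕ} (hi : PT i) (hm : PT m)
    (hf : PT fun q : X × ℕ => f q.1 q.2) (hf' : PT fun q : X × ℕ => f' q.1 q.2)
    (hg : PT fun q : X × ℕ => g q.1 q.2) (hg' : PT fun q : X × ℕ => g' q.1 q.2) :
    PTPred fun x => LexGe (i x) (m x) (fun j => (f x j : ℤ) - f' x j)
      fun j => (g x j : ℤ) - g' x j := by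
  refine (PTPred.forall_lt (p := fun x j => i x ≤ j → (∀ j' < j, i x ≤ j' →
    f x j' + g' x j' = g x j' + f' x j') → g x j + f' x j ≤ f x j + g' x j) hm.succ
    ((PTPred.le hi.wk PT.var).imp (.imp (.forall_lt (X := X × ℕ) (p := fun q j' => i q.1 ≤ j' →
      f q.1 j' + g' q.1 j' = g q.1 j' + f' q.1 j') PT.var ?_)
      (.le (hg.add hf') (hf.add hg'))))).congr fun x => ?_
  · exact (PTPred.le hi.wk.wk PT.var).imp
      (.eq (hf.wkMid.add hg'.wkMid) (hg.wkMid.add hf'.wkMid))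
  · refine ⟨fun h j hij hjm he => ?_, fun h j hjm hij he => ?_⟩
    · have := h j (by lia) hij fun j' h1 h2 => by
        have := he j' h2 h1
        lia
      lia
    · have := h j hij (by lia) fun j' h1 h2 => by
        have := he j' h2 h1
        lia
      lia

/-- The sets `A x` are subsets of `range (n x)` with a membership relation that can be decided in
polynomial time. -/
def PTSet (n : X → ℕ) (A : X → Finset ℕ) : Prop :=
  PT n ∧ (∀ x, A x ⊆ Finset.range (n x)) ∧ PTPred fun q : X × ℕ => q.2 ∈ A q.1

theorem PT.sum_finset {n : X → ℕ} {A : X → Finset ℕ} (hA : PTSet n A) {g : X → ℕ → ℕ}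
    (hg : PT fun q : X × ℕ => g q.1 q.2) : PT fun x => ∑ u ∈ A x, g x u := by
  refine (PT.sum (g := fun x u => if u ∈ A x then g x u else 0) hA.1
    (.ite hA.2.2 hg PT.zero)).congr fun x => ?_
  rw [← Finset.sum_filter, Finset.filter_mem_eq_inter, Finset.inter_eq_right.2 (hA.2.1 x)]

theorem PTSet.wk {n : X → ℕ} {A : X → Finset ℕ} (hA : PTSet n A) :
    PTSet (fun q : X × ℕ => n q.1) fun q => A q.1 :=
  ⟨hA.1.wk, fun q => hA.2.1 q.1, PT.wkMid hA.2.2⟩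

theorem PTSet.card {n : X → ℕ} {A : X → Finset ℕ} (hA : PTSet n A) : PT fun x => (A x).card :=
  (PT.sum_finset hA (g := fun _ _ => 1) (.const 1)).congr fun _ => (Finset.card_eq_sum_ones _).symm

variable {B c d i : X → ℕ}

theorem PT.posBound (hm : PT m) (hV : PT nV) (hU : PT nU) :
    PT fun x => posBound (m x) (nV x) (nU x) :=
  (((hV.add hU).mul hm).add hm).succ

theorem PT.voteWeight {j r a : X → ℕ} (hm : PT m) (hB : PT B) (hj : PT j) (hr : PT r) (ha : PT a) :
    PT fun x => voteWeight (_root_.readPos (inp x) (m x)) (B x) (j x) (r x) (a x) :=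
  have hp := PT.readPos hm hr ha
  .ite (.le hp hj) (hB.sub hp) .zero

theorem PT.tableScore {n : X → ℕ} {A : X → Finset ℕ} {j a : X → ℕ} (hm : PT m) (hV : PT nV)
    (hA : PTSet n A) (hj : PT j) (ha : PT a) :
    PT fun x => tableScore (_root_.readPos (inp x) (m x)) (nV x) (A x) (j x) (a x) :=
  (PT.sum (g := fun x r => if _root_.readPos (inp x) (m x) r (a x) ≤ j x then 1 else 0) hV
    (PTPred.le (PT.readPos (X := X × ℕ) hm.wk PT.var ha.wk) hj.wk).toPT).add
  (PT.sum_finset (g := fun x u => if _root_.readPos (inp x) (m x) (nV x + u) (a x) ≤ j x then 1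
    else 0) hA
    (PTPred.le (PT.readPos (X := X × ℕ) hm.wk (hV.wk.add PT.var) ha.wk) hj.wk).toPT)

theorem PT.tableWeight {n : X → ℕ} {A : X → Finset ℕ} {j a : X → ℕ} (hm : PT m) (hV : PT nV)
    (hB : PT B) (hA : PTSet n A) (hj : PT j) (ha : PT a) :
    PT fun x => tableWeight (_root_.readPos (inp x) (m x)) (nV x) (B x) (A x) (j x) (a x) :=
  (PT.sum (g := fun x r => _root_.voteWeight (_root_.readPos (inp x) (m x)) (B x) (j x) r (a x)) hV
    (PT.voteWeight (X := X × ℕ) hm.wk hB.wk hj.wk PT.var ha.wk)).add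
  (PT.sum_finset (g := fun x u => _root_.voteWeight (_root_.readPos (inp x) (m x)) (B x) (j x)
    (nV x + u) (a x)) hA
    (PT.voteWeight (X := X × ℕ) hm.wk hB.wk hj.wk (hV.wk.add PT.var) ha.wk))

theorem PTPred.spoils {n : X → ℕ} {A : X → Finset ℕ} (hm : PT m) (hV : PT nV) (hB : PT B)
    (hc : PT c) (hd : PT d) (hi : PT i) (hA : PTSet n A) : PTPred fun x =>
      Spoils (readPos (inp x) (m x)) (nV x) (B x) (m x) (c x) (d x) (i x) (A x) := by
  refine (PTPred.le ((PT.const 2).mul (PT.tableScore hm hV hA hi.pred hc)) (hV.add hA.card)).and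
    ((PTPred.lt (hV.add hA.card) ((PT.const 2).mul (PT.tableScore hm hV hA hi hd))).and ?_)
  have h : ∀ {a : X → ℕ}, PT a → PT fun q : X × ℕ => tableWeight (readPos (inp q.1) (m q.1))
      (nV q.1) (B q.1) (A q.1) q.2 (a q.1) := fun ha =>
    PT.tableWeight (X := X × ℕ) hm.wk hV.wk hB.wk hA.wk PT.var ha.wk
  exact (PTPred.lexGe
    (f := fun x j => tableWeight (readPos (inp x) (m x)) (nV x) (B x) (A x) j (d x))
    (f' := fun _ _ => 0)
    (g := fun x j => tableWeight (readPos (inp x) (m x)) (nV x) (B x) (A x) j (c x))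
    (g' := fun _ _ => 0) hi hm (h hd) .zero (h hc) .zero).congr fun x => by simp

theorem PT.voteClass {u : X → ℕ} (hm : PT m) (hV : PT nV) (hc : PT c) (hd : PT d) (hi : PT i)
    (hu : PT u) :
    PT fun x => voteClass (_root_.readPos (inp x) (m x)) (nV x) (c x) (d x) (i x) (u x) :=
  have hr := hV.add hu
  ((PT.const 2).mul (PTPred.le (.readPos hm hr hc) hi.pred).toPT).add
    (PTPred.le (.readPos hm hr hd) hi).toPT

theorem PTPred.lexGe_advantage {u u' : X → ℕ} (hm : PT m) (hV : PT nV) (hB : PT B) (hc : PT c)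
    (hd : PT d) (hi : PT i) (hu : PT u) (hu' : PT u') : PTPred fun x =>
      LexGe (i x) (m x) (advantage (readPos (inp x) (m x)) (nV x) (B x) (c x) (d x) (u x))
        (advantage (readPos (inp x) (m x)) (nV x) (B x) (c x) (d x) (u' x)) := by
  have h : ∀ {a u : X → ℕ}, PT a → PT u → PT fun q : X × ℕ => voteWeight
      (readPos (inp q.1) (m q.1)) (B q.1) q.2 (nV q.1 + u q.1) (a q.1) := fun ha hu =>
    PT.voteWeight (X := X × ℕ) hm.wk hB.wk PT.var (hV.wk.add hu.wk) ha.wk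
  exact PTPred.lexGe
    (f := fun x j => voteWeight (readPos (inp x) (m x)) (B x) j (nV x + u x) (d x))
    (f' := fun x j => voteWeight (readPos (inp x) (m x)) (B x) j (nV x + u x) (c x))
    (g := fun x j => voteWeight (readPos (inp x) (m x)) (B x) j (nV x + u' x) (d x))
    (g' := fun x j => voteWeight (readPos (inp x) (m x)) (B x) j (nV x + u' x) (c x))
    hi hm (h hd hu) (h hc hu) (h hd hu') (h hc hu')

theorem preferred_lexKey_iff {i m : ℕ} {f : ℕ → ℕ → ℤ} {u' u : ℕ} :
    Preferred (fun u => lexKey i m (f u)) u' u ↔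
      ¬ LexGe i m (f u) (f u') ∨ (LexGe i m (f u) (f u') ∧ LexGe i m (f u') (f u)) ∧ u' < u := by
  unfold Preferred
  rw [← lexKey_le_iff, ← lexKey_le_iff, not_le, le_antisymm_iff,
    and_comm (a := lexKey i m (f u) ≤ lexKey i m (f u'))]

/-- The greedy choice is made in polynomial time by counting, for every vote, the preferred votes of
its class. -/
theorem PTSet.bestVotes {q : X → ℕ → ℕ} (hm : PT m) (hV : PT nV) (hU : PT nU) (hB : PT B)
    (hc : PT c) (hd : PT d) (hi : PT i) (hq : PT fun y : X × ℕ => q y.1 y.2) :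
    PTSet nU fun x => bestVotes (readPos (inp x) (m x)) (nV x) (nU x) (B x) (m x) (c x) (d x) (i x)
      (q x) := by
  classical
  refine ⟨hU, fun x => Finset.filter_subset _ _, ?_⟩
  have hcl : PT fun y : X × ℕ => voteClass (readPos (inp y.1) (m y.1)) (nV y.1) (c y.1) (d y.1)
      (i y.1) y.2 :=
    PT.voteClass (X := X × ℕ) hm.wk hV.wk hc.wk hd.wk hi.wk PT.var
  have h1 : PTPred fun y : (X × ℕ) × ℕ => LexGe (i y.1.1) (m y.1.1)
      (advantage (readPos (inp y.1.1) (m y.1.1)) (nV y.1.1) (B y.1.1) (c y.1.1) (d y.1.1) y.1.2)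
      (advantage (readPos (inp y.1.1) (m y.1.1)) (nV y.1.1) (B y.1.1) (c y.1.1) (d y.1.1) y.2) :=
    PTPred.lexGe_advantage (X := (X × ℕ) × ℕ) hm.wk.wk hV.wk.wk hB.wk.wk hc.wk.wk hd.wk.wk
      hi.wk.wk PT.var.wk PT.var
  have h2 : PTPred fun y : (X × ℕ) × ℕ => LexGe (i y.1.1) (m y.1.1)
      (advantage (readPos (inp y.1.1) (m y.1.1)) (nV y.1.1) (B y.1.1) (c y.1.1) (d y.1.1) y.2)
      (advantage (readPos (inp y.1.1) (m y.1.1)) (nV y.1.1) (B y.1.1) (c y.1.1) (d y.1.1) y.1.2) :=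
    PTPred.lexGe_advantage (X := (X × ℕ) × ℕ) hm.wk.wk hV.wk.wk hB.wk.wk hc.wk.wk hd.wk.wk
      hi.wk.wk PT.var PT.var.wk
  have hrank := PT.sum (X := X × ℕ) (n := fun y => nU y.1) (g := fun y u' => if
    voteClass (readPos (inp y.1) (m y.1)) (nV y.1) (c y.1) (d y.1) (i y.1) u' =
      voteClass (readPos (inp y.1) (m y.1)) (nV y.1) (c y.1) (d y.1) (i y.1) y.2 ∧
    (¬ LexGe (i y.1) (m y.1)
        (advantage (readPos (inp y.1) (m y.1)) (nV y.1) (B y.1) (c y.1) (d y.1) y.2)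
        (advantage (readPos (inp y.1) (m y.1)) (nV y.1) (B y.1) (c y.1) (d y.1) u') ∨
      (LexGe (i y.1) (m y.1)
        (advantage (readPos (inp y.1) (m y.1)) (nV y.1) (B y.1) (c y.1) (d y.1) y.2)
        (advantage (readPos (inp y.1) (m y.1)) (nV y.1) (B y.1) (c y.1) (d y.1) u') ∧
      LexGe (i y.1) (m y.1)
        (advantage (readPos (inp y.1) (m y.1)) (nV y.1) (B y.1) (c y.1) (d y.1) u')
        (advantage (readPos (inp y.1) (m y.1)) (nV y.1) (B y.1) (c y.1) (d y.1) y.2)) ∧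
      u' < y.2) then 1 else 0) hU.wk
    ((PTPred.eq hcl.wkMid hcl.wk).and
      (h1.not.or ((h1.and h2).and (PTPred.lt PT.var PT.var.wk)))).toPT
  refine ((PTPred.lt PT.var hU.wk).and (PTPred.lt hrank (hq.wkMid.subst hcl))).congr fun y => ?_
  simp only [_root_.bestVotes, greedy, rankIn, Finset.mem_filter, Finset.mem_range,
    preferred_lexKey_iff, Finset.card_filter]

theorem PTPred.readsYes (hm : PT m) (hV : PT nV) (hU : PT nU) (hc : PT c) :
    PTPred fun x => ReadsYes (inp x) (m x) (nV x) (nU x) (c x) := by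
  have hB := PT.posBound hm hV hU
  refine ((PTPred.eq hV .zero).and (.le (.const 2) hm)).or ?_
  refine .exists_lt hm (.and (PTPred.eq PT.var hc.wk).not (.exists_lt hm.succ.wk
    (.and (.le (.const 1) PT.var) (.exists_lt hU.succ.wk.wk (.exists_lt hU.succ.wk.wk.wk
      (.exists_lt hU.succ.wk.wk.wk.wk (.exists_lt hU.succ.wk.wk.wk.wk.wk ?_)))))))
  -- Bound variables, from the inside: the vote class, `q₃`, `q₂`, `q₁`, `q₀`, `i`, `d`.
  have hq : PT fun y : ((((((X × ℕ) × ℕ) × ℕ) × ℕ) × ℕ) × ℕ) × ℕ =>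
      quotas y.1.1.1.1.2 y.1.1.1.2 y.1.1.2 y.1.2 y.2 :=
    .ite (.eq PT.var .zero) PT.var.wk.wk.wk.wk (.ite (.eq PT.var (.const 1)) PT.var.wk.wk.wk
      (.ite (.eq PT.var (.const 2)) PT.var.wk.wk PT.var.wk))
  have hA := PTSet.bestVotes (X := (((((X × ℕ) × ℕ) × ℕ) × ℕ) × ℕ) × ℕ)
    (q := fun y => quotas y.1.1.1.2 y.1.1.2 y.1.2 y.2)
    hm.wk.wk.wk.wk.wk.wk hV.wk.wk.wk.wk.wk.wk hU.wk.wk.wk.wk.wk.wk hB.wk.wk.wk.wk.wk.wk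
    hc.wk.wk.wk.wk.wk.wk (d := fun y => y.1.1.1.1.1.2) PT.var.wk.wk.wk.wk.wk
    (i := fun y => y.1.1.1.1.2) PT.var.wk.wk.wk.wk hq
  have hk := PT.min_binVal (.piece (PT.targetIdx hm hV hU).succ) hU
  refine .and (.le hA.card hk.wk.wk.wk.wk.wk.wk) ?_
  · exact PTPred.spoils (X := (((((X × ℕ) × ℕ) × ℕ) × ℕ) × ℕ) × ℕ)
      hm.wk.wk.wk.wk.wk.wk hV.wk.wk.wk.wk.wk.wk hB.wk.wk.wk.wk.wk.wk
      hc.wk.wk.wk.wk.wk.wk (d := fun y => y.1.1.1.1.1.2) PT.var.wk.wk.wk.wk.wk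
      (i := fun y => y.1.1.1.1.2) PT.var.wk.wk.wk.wk hA

end Membership

/-! ### The algorithm -/

theorem theorem6 : InP (DCAV sksWinners) := by
  refine PTPred.inP (PTPred.congr ?_ fun w => mem_DCAV_iff.symm)
  have hw : PT fun w : List Γ' => w.length + 1 := PT.length.succ
  refine .exists_lt hw (.exists_lt hw.wk (.exists_lt hw.wk.wk
    (.exists_lt PT.var.wk.wk (.and ?_ ?_))))
  · exact PTPred.readsInstance (X := (((List Γ' × ℕ) × ℕ) × ℕ) × ℕ) (m := fun q => q.1.1.1.2)
      (nV := fun q => q.1.1.2) (nU := fun q => q.1.2) (c := fun q => q.2)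
      PT.var.wk.wk.wk PT.var.wk.wk PT.var.wk PT.var
  · exact PTPred.readsYes (X := (((List Γ' × ℕ) × ℕ) × ℕ) × ℕ) (m := fun q => q.1.1.1.2)
      (nV := fun q => q.1.1.2) (nU := fun q => q.1.2) (c := fun q => q.2)
      PT.var.wk.wk.wk PT.var.wk.wk PT.var.wk PT.var
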